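/- Let $A$ be a finite alphabet and let $\xi=(\xi_i)_{i\in\mathbb Z}$ be an $A$-valued process with distribution $\mu$ on $A^{\mathbb Z}$. Assume that $\xi$ is an IASFT (irreducible aperiodic subshift of finite type). That is, there is an adjacency matrix $M=(M_{ab})_{a,b\in A}$ with entries in $\{0,1\}$ that is irreducible (for all $a,b\in A$ there is $k\ge 1$ with $(M^k)_{ab}>0$) and aperiodic (for all $a\in A$, $\gcd\{k\ge1:(M^k)_{aa}>0\}=1$), and $\mu$ is a measure of maximal entropy on $\Sigma_M=\{x\in A^{\mathbb Z}: M_{x_ix_{i+1}}=1\ \forall i\in\mathbb Z\}$: it is a shift-invariant probability measure with $\mu(\Sigma_M)=1$, and its entropy $h(\mu)$ is at least $h(\nu)$ for every shift-invariant probability measure $\nu$ with $\nu(\Sigma_M)=1$. Here $h(\nu)=\lim_{n\to\infty}\frac1n H_\nu(x_0,\dots,x_{n-1})$, with $H_\nu$ the Shannon entropy. Assume also that $\xi$ has the PIJ property: there exist a probability measure $\lambda$ on $(A^{\mathbb Z})^3$, the joint distribution of a triple $(\xi,\xi',\xi'')$, invariant under the simultaneous shift of the three coordinates, whose three marginals on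 $A^{\mathbb Z}$ equal $\mu$ and whose three two-dimensional marginals equal $\mu\otimes\mu$, and a continuous function $\varphi:A^{\mathbb Z}\times A^{\mathbb Z}\to A$ with $\xi''_0=\varphi(\xi,\xi')$ $\lambda$-almost everywhere ($A$ is discrete and $A^{\mathbb Z}$ has the product topology). Then for all large enough integers $k$, the past $\xi_{-\infty}^{0}=(\xi_i)_{i\le 0}$ and the future $\xi_k^{+\infty}=(\xi_i)_{i\ge k}$ are independent. If, moreover, the subshift is uniform, that is, if there is a nonnegative integer $n$ such that every row and every column of $M$ sums to $n$ (each vertex has $n$ outgoing and $n$ incoming edges, and $n$ is then the Perron value of $M$), then for all large enough $k$ every entry of $M^k$ is equal to $n^k/|A|$. -/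

import Mathlib

open Filter MeasureTheory ProbabilityTheory

namespace PIJ

/-- The left shift `(shift x) i = x (1 + i)` on bi-infinite sequences. -/
abbrev shift {A : Type*} : (ℤ → A) → (ℤ → A) :=
  SymbolicDynamics.FullShift.shift (1 : ℤ)

/-- The probability distribution on `A^ℤ` of a process `ξ = (ξ i)`, `i ∈ ℤ`. -/
noncomputable def law {A Ω : Type*} [MeasurableSpace A] [MeasurableSpace Ω]
    (P : Measure Ω) (ξ : ℤ → Ω → A) : Measure (ℤ → A) :=
  P.map (fun ω i => ξ i ω)

/-! ### Self-joinings -/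

/-- A `k`-fold self-joining of the process with distribution `μ`: a distribution on `(A^ℤ)^k`,
invariant under the simultaneous shift of the `k` coordinates, all of whose marginals on `A^ℤ`
are equal to `μ`. -/
structure IsSelfJoining {A : Type*} [MeasurableSpace A] (μ : Measure (ℤ → A)) (k : ℕ)
    (lam : Measure (Fin k → ℤ → A)) : Prop where
  stationary : MeasurePreserving (fun (z : Fin k → ℤ → A) (j : Fin k) => shift (z j)) lam lam
  marginal : ∀ j : Fin k, lam.map (fun z => z j) = μ

/-- A pairwise-independent joining: a 3-fold self-joining whose two-dimensional marginals are
all equal to `μ ⊗ μ`. -/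
structure IsPairwiseIndepJoining {A : Type*} [MeasurableSpace A] (μ : Measure (ℤ → A))
    (lam : Measure (Fin 3 → ℤ → A)) : Prop where
  selfJoining : IsSelfJoining μ 3 lam
  pairwise : ∀ i j : Fin 3, i ≠ j → lam.map (fun z => (z i, z j)) = μ.prod μ

/-- The PIJ property: there are a pairwise-independent joining of `(ξ, ξ', ξ'')` (here `z 0`,
`z 1`, `z 2`) and a continuous `φ` with `ξ''_0 = φ (ξ, ξ')` almost everywhere. -/
def HasPIJ {A : Type*} [TopologicalSpace A] [MeasurableSpace A] (μ : Measure (ℤ → A)) : Prop :=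
  ∃ (lam : Measure (Fin 3 → ℤ → A)) (φ : (ℤ → A) × (ℤ → A) → A),
    IsPairwiseIndepJoining μ lam ∧ Continuous φ ∧ ∀ᵐ z ∂lam, z 2 0 = φ (z 0, z 1)

/-! ### Entropy -/

/-- The Shannon entropy of `(x_0, …, x_{n-1})` under `μ`. -/
noncomputable def blockEntropy {A : Type*} [Fintype A] [MeasurableSpace A]
    (μ : Measure (ℤ → A)) (n : ℕ) : ℝ :=
  ∑ w : Fin n → A, Real.negMulLog (μ.real {x | ∀ i : Fin n, x ((i : ℕ) : ℤ) = w i})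

/-- The entropy of a stationary process with distribution `μ`, the limit of
`blockEntropy μ n / n` (this sequence lies in `[0, log |A|]` for `n ≥ 1` and converges when `μ` is
shift-invariant, so that the upper limit is the limit). -/
noncomputable def entropy {A : Type*} [Fintype A] [MeasurableSpace A]
    (μ : Measure (ℤ → A)) : ℝ :=
  limsup (fun n : ℕ => blockEntropy μ n / n) atTop

/-- `μ` is a shift-invariant probability measure carried by `S`. -/
structure IsInvariantProbOn {A : Type*} [MeasurableSpace A] (S : Set (ℤ → A))
    (μ : Measure (ℤ → A)) : Prop where
  isProbabilityMeasure : IsProbabilityMeasure μ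
  invariant : MeasurePreserving shift μ μ
  carried : ∀ᵐ x ∂μ, x ∈ S

/-- `μ` is a measure of maximal entropy on `S`. -/
structure IsMaxEntropy {A : Type*} [Fintype A] [MeasurableSpace A] (S : Set (ℤ → A))
    (μ : Measure (ℤ → A)) : Prop where
  invariantProb : IsInvariantProbOn S μ
  maximal : ∀ ν : Measure (ℤ → A), IsInvariantProbOn S ν → entropy ν ≤ entropy μ

/-! ### Subshifts of finite type -/

/-- The subshift of finite type with adjacency matrix `M`: all sequences in which every pattern
`ab` of two consecutive symbols is allowed, that is `M a b = 1`. -/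
def subshift {A : Type*} (M : Matrix A A ℤ) : Set (ℤ → A) :=
  {x | ∀ i : ℤ, M (x i) (x (i + 1)) = 1}

/-- `M` is aperiodic: for every `a`, the greatest common divisor of the return times
`{k ≥ 1 : (M ^ k) a a > 0}` is `1`. -/
def IsAperiodic {A : Type*} [Fintype A] [DecidableEq A] (M : Matrix A A ℤ) : Prop :=
  ∀ (a : A) (d : ℕ), (∀ k : ℕ, 1 ≤ k → 0 < (M ^ k) a a → d ∣ k) → d = 1

/-- `μ` is the distribution of the irreducible aperiodic subshift of finite type with 0-1 adjacency
matrix `M`, endowed with its measure of maximal entropy. -/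
structure IsIASFT {A : Type*} [Fintype A] [DecidableEq A] [MeasurableSpace A]
    (M : Matrix A A ℤ) (μ : Measure (ℤ → A)) : Prop where
  zero_one : ∀ a b, M a b = 0 ∨ M a b = 1
  irreducible : M.IsIrreducible
  aperiodic : IsAperiodic M
  maxEntropy : IsMaxEntropy (subshift M) μ

/-- The subshift with adjacency matrix `M` is uniform of degree `n`: each vertex has `n` outgoing
and `n` incoming edges. -/
def IsUniform {A : Type*} [Fintype A] (M : Matrix A A ℤ) (n : ℕ) : Prop :=
  (∀ a, ∑ b, M a b = n) ∧ ∀ b, ∑ a, M a b = n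

end PIJ

namespace PIJ

/-! ### Perron eigenvectors and the Parry chain -/

section Matrices

variable {A : Type*} [Fintype A] [DecidableEq A]

/-! The core is a fact about discrete variables, `indepFun_of_pairwise`. Let `Z₁ = F₁ X₁ Y₁` and `Z₂
= F₂ X₂ Y₂`, where the pairs `X`, `Y`, `Z` are pairwise independent. Conditioning on `Y = (c, d)`
does not change the law of `Z`, which is therefore the law of `(F₁ X₁ c, F₂ X₂ d)`. If `(c, d)` has
positive probability whenever `c` and `d` do, this may be averaged over the product of the laws of
`Y₁` and `Y₂` instead of their joint law. For fixed `X` that average factors, and since `Z` is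
independent of `X` the factors are the laws of `Z₁` and `Z₂`.

A continuous `φ` sees a finite window only, so blocks of `ξ''` are functions of slightly longer
blocks of `ξ` and `ξ'`, and the fact applies to two distant blocks. Its support condition holds
because words of positive probability are exactly the paths of the graph, and `M ^ k` is entrywise
positive for large `k`.

Maximal entropy enters through this description of the support. With Perron value `t`, the Parry
chain has entropy at least `log t`, while Gibbs' inequality bounds each increment of the block
entropies of `μ` after the first by `log t`. Equality forces the Parry transition probabilities,
which are positive on every edge. In the uniform case they are `M a b / n`, so independence at
distance `k` reads `(M ^ k) a b = n ^ k * μ(b)`, and column sums give `μ(b) = 1 / |A|`. -/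

theorem pow_pos_of_pow_pos {R : Type*} [Ring R] [LinearOrder R] [IsStrictOrderedRing R]
    {M : Matrix A A R} (hM : ∀ a b, 0 ≤ M a b)
    {i j : ℕ} {a b c : A} (h₁ : 0 < (M ^ i) a b) (h₂ : 0 < (M ^ j) b c) :
    0 < (M ^ (i + j)) a c := by
  rw [pow_add, Matrix.mul_apply]
  exact (mul_pos h₁ h₂).trans_le (Finset.single_le_sum
    (f := fun b => (M ^ i) a b * (M ^ j) b c)
    (fun b _ => mul_nonneg (Matrix.pow_apply_nonneg hM i a b) (Matrix.pow_apply_nonneg hM j b c))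
    (Finset.mem_univ b))

/-- All large powers of an irreducible aperiodic matrix are entrywise positive. -/
theorem eventually_pow_pos {M : Matrix A A ℤ} (hirr : M.IsIrreducible) (hap : IsAperiodic M) :
    ∀ᶠ k : ℕ in atTop, ∀ a b, 0 < (M ^ k) a b := by
  have hpath := (Matrix.isIrreducible_iff_exists_pow_pos hirr.nonneg).1 hirr
  have hloop : ∀ a, ∃ n, ∀ m ≥ n, 0 < (M ^ m) a a := by
    intro a
    -- The return times to `a` form an additive submonoid of ℕ with gcd 1, hence contain all large
    -- integers.
    let s : AddSubmonoid ℕ :=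
      { carrier := {k | 0 < (M ^ k) a a}
        zero_mem' := by simp
        add_mem' := fun hi hj => pow_pos_of_pow_pos hirr.nonneg hi hj }
    obtain ⟨n, hn⟩ := Nat.exists_mem_closure_of_ge (s : Set ℕ)
    refine ⟨n, fun m hm => ?_⟩
    have hgcd : Nat.setGcd (s : Set ℕ) = 1 :=
      hap a _ fun k _ hk => Nat.setGcd_dvd_of_mem (s := (s : Set ℕ)) hk
    have := hn m hm (by rw [hgcd]; exact one_dvd m)
    rwa [AddSubmonoid.closure_eq] at this
  choose n hn using hloop
  choose l _ hl using hpath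
  rw [eventually_all]
  intro a
  rw [eventually_all]
  intro b
  filter_upwards [eventually_ge_atTop (n a + l a b)] with k hk
  have := pow_pos_of_pow_pos hirr.nonneg (hn a (k - l a b) (by omega)) (hl a b)
  rwa [Nat.sub_add_cancel (by omega)] at this

omit [DecidableEq A] in
theorem mulVec_pos {R : Matrix A A ℝ} (hR : ∀ a b, 0 < R a b) {v : A → ℝ} (hv : ∀ a, 0 ≤ v a)
    (hv' : v ≠ 0) (a : A) : 0 < R.mulVec v a := by
  obtain ⟨b, hb⟩ := Function.ne_iff.1 hv'
  exact Finset.sum_pos' (fun c _ => mul_nonneg (hR a c).le (hv c))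
    ⟨b, Finset.mem_univ b, mul_pos (hR a b) ((hv b).lt_of_ne' hb)⟩

/-- A nonnegative matrix with a positive power has a positive eigenvector with a positive
eigenvalue. -/
theorem exists_perron [Nonempty A] {R : Matrix A A ℝ} (hR : ∀ a b, 0 ≤ R a b) {N : ℕ} (hN : N ≠ 0)
    (hpos : ∀ a b, 0 < (R ^ N) a b) :
    ∃ (t : ℝ) (x : A → ℝ), 0 < t ∧ (∀ a, 0 < x a) ∧ R.mulVec x = t • x := by
  -- Collatz–Wielandt: maximise `t` subject to `t x ≤ R x` with `x` in the simplex. Summing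
  -- coordinates gives `t ≤ C`, so restricting to `[0, C]` loses nothing and makes the problem
  -- compact.
  set C : ℝ := ∑ a, ∑ b, R a b
  let K : Set ((A → ℝ) × ℝ) := {q | ∀ a, q.2 * q.1 a ≤ R.mulVec q.1 a}
  have hKclosed : IsClosed K := by
    simp only [K, Set.ofPred_forall, Matrix.mulVec, dotProduct]
    refine isClosed_iInter fun a => isClosed_le (by fun_prop) (by fun_prop)
  have hcomp : IsCompact ((stdSimplex ℝ A ×ˢ Set.Icc 0 C) ∩ K) :=
    ((isCompact_stdSimplex ℝ A).prod isCompact_Icc).inter_right hKclosed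
  have hC : 0 ≤ C := Finset.sum_nonneg fun a _ => Finset.sum_nonneg fun b _ => hR a b
  have hnonneg : ∀ x : A → ℝ, (∀ a, 0 ≤ x a) → ∀ a, 0 ≤ R.mulVec x a := fun x hx a =>
    Finset.sum_nonneg fun b _ => mul_nonneg (hR a b) (hx b)
  have hne : ((stdSimplex ℝ A ×ˢ Set.Icc 0 C) ∩ K).Nonempty := by
    obtain ⟨x, hx⟩ : (stdSimplex ℝ A).Nonempty :=
      ⟨_, single_mem_stdSimplex ℝ (Classical.arbitrary A)⟩
    exact ⟨(x, 0), ⟨hx, by simp [hC]⟩, fun a => by simpa using hnonneg x hx.1 a⟩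
  obtain ⟨⟨x, t⟩, ⟨⟨hx, ht⟩, hxt⟩, hmax⟩ := hcomp.exists_isMaxOn hne continuous_snd.continuousOn
  replace ht : 0 ≤ t ∧ t ≤ C := ht
  have hx1 : ∀ a, x a ≤ 1 := fun a =>
    hx.2 ▸ Finset.single_le_sum (f := x) (fun b _ => hx.1 b) (Finset.mem_univ a)
  have hx0 : x ≠ 0 := by
    rintro rfl
    simpa using hx.2
  have heig : R.mulVec x = t • x := by
    by_contra hcon
    -- A nonzero defect `v ≥ 0` becomes strictly positive under `R ^ N`, so at `y = R ^ N x` the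
    -- value `t` can be raised by some `ε`, against maximality.
    set v : A → ℝ := R.mulVec x - t • x with hv
    have hv0 : v ≠ 0 := sub_ne_zero.2 hcon
    have hvn : ∀ a, 0 ≤ v a := fun a => by simpa [hv] using hxt a
    set y := (R ^ N).mulVec x with hy
    have hypos : ∀ a, 0 < y a := mulVec_pos hpos hx.1 hx0
    have hwpos : ∀ a, 0 < (R ^ N).mulVec v a := mulVec_pos hpos hvn hv0
    have hw : (R ^ N).mulVec v = R.mulVec y - t • y := by
      rw [hv, Matrix.mulVec_sub, Matrix.mulVec_smul, hy, Matrix.mulVec_mulVec, Matrix.mulVec_mulVec,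
        ← pow_succ, ← pow_succ']
    obtain ⟨c, -, hc⟩ := Finset.exists_min_image Finset.univ
      (fun a => (R ^ N).mulVec v a / y a) Finset.univ_nonempty
    set ε := (R ^ N).mulVec v c / y c
    have hε : 0 < ε := div_pos (hwpos c) (hypos c)
    set s := ∑ a, y a
    have hs : 0 < s := Finset.sum_pos (fun a _ => hypos a) Finset.univ_nonempty
    set z := s⁻¹ • y with hz
    have hzS : z ∈ stdSimplex ℝ A := by
      refine ⟨fun a => mul_nonneg (inv_nonneg.2 hs.le) (hypos a).le, ?_⟩
      simp only [hz, Pi.smul_apply, smul_eq_mul, ← Finset.mul_sum]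
      exact inv_mul_cancel₀ hs.ne'
    have hzK : ∀ a, (t + ε) * z a ≤ R.mulVec z a := by
      intro a
      have h1 : ε * y a ≤ (R ^ N).mulVec v a := (le_div_iff₀ (hypos a)).1 (hc a (Finset.mem_univ a))
      rw [hw] at h1
      simp only [Pi.sub_apply, Pi.smul_apply, smul_eq_mul] at h1
      rw [hz, Matrix.mulVec_smul]
      simp only [Pi.smul_apply, smul_eq_mul]
      have := mul_le_mul_of_nonneg_left h1 (inv_nonneg.2 hs.le)
      linarith
    have hzC : t + ε ≤ C := by
      calc t + ε = ∑ a, (t + ε) * z a := by rw [← Finset.mul_sum, hzS.2, mul_one]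
        _ ≤ ∑ a, R.mulVec z a := Finset.sum_le_sum fun a _ => hzK a
        _ ≤ C := Finset.sum_le_sum fun a _ => Finset.sum_le_sum fun b _ =>
            mul_le_of_le_one_right (hR a b)
              (hzS.2 ▸ Finset.single_le_sum (f := z) (fun b _ => hzS.1 b) (Finset.mem_univ b))
    have : t + ε ≤ t := hmax (a := (z, t + ε)) ⟨⟨hzS, ⟨by linarith, hzC⟩⟩, hzK⟩
    linarith
  have hpow : ∀ n : ℕ, (R ^ n).mulVec x = t ^ n • x := by
    intro n
    induction n with
    | zero => simp
    | succ n ih => rw [pow_succ, ← Matrix.mulVec_mulVec, heig, Matrix.mulVec_smul, ih, smul_smul,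
        pow_succ, mul_comm]
  have hprod : ∀ a, 0 < t ^ N * x a := fun a => by
    have := mulVec_pos hpos hx.1 hx0 a
    rwa [hpow] at this
  have htpos : 0 < t := by
    refine ht.1.lt_of_ne' ?_
    rintro rfl
    simpa [hN] using hprod (Classical.arbitrary A)
  exact ⟨t, x, htpos, fun a => pos_of_mul_pos_right (hprod a) (pow_pos htpos N).le, heig⟩

/-- A stochastic matrix `p` with a positive stationary vector `π`. -/
structure IsStationaryChain (p : Matrix A A ℝ) (π : A → ℝ) : Prop where
  nonneg : ∀ a b, 0 ≤ p a b
  sum_row : ∀ a, ∑ b, p a b = 1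
  init_pos : ∀ a, 0 < π a
  sum_init : ∑ a, π a = 1
  stationary : ∀ b, ∑ a, π a * p a b = π b

/-- The transition probabilities of the Parry measure. -/
noncomputable def parryMatrix (R : Matrix A A ℝ) (t : ℝ) (r : A → ℝ) : Matrix A A ℝ :=
  Matrix.of fun a b => R a b * r b / (t * r a)

/-- Perron eigenvectors of a matrix with a positive power yield a stationary Markov chain. -/
theorem exists_parry [Nonempty A] {R : Matrix A A ℝ} (hR : ∀ a b, 0 ≤ R a b) {N : ℕ} (hN : N ≠ 0)
    (hpos : ∀ a b, 0 < (R ^ N) a b) {t : ℝ} {r : A → ℝ} (ht : 0 < t) (hr : ∀ a, 0 < r a)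
    (hrt : R.mulVec r = t • r) : ∃ π, IsStationaryChain (parryMatrix R t r) π := by
  -- With a left eigenvector `l`, the stationary vector is `l a * r a`, normalised. Evaluating `l R
  -- r` in two ways shows that the two eigenvalues agree.
  obtain ⟨t', l, ht', hl, hlt⟩ := exists_perron (R := R.transpose) (fun a b => hR b a) hN
    (fun a b => by rw [← Matrix.transpose_pow]; exact hpos b a)
  have hrt' : ∀ a, ∑ b, R a b * r b = t * r a := fun a => congrFun hrt a
  have hlt' : ∀ b, ∑ a, R a b * l a = t' * l b := fun b => congrFun hlt b
  set s := ∑ a, l a * r a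
  have hs : 0 < s := Finset.sum_pos (fun a _ => mul_pos (hl a) (hr a)) Finset.univ_nonempty
  have htt : t' = t := by
    have h1 : ∑ b, ∑ a, R a b * l a * r b = t' * s := by
      simp_rw [← Finset.sum_mul, hlt', s, Finset.mul_sum, mul_assoc]
    have h2 : ∑ b, ∑ a, R a b * l a * r b = t * s := by
      rw [Finset.sum_comm]
      simp_rw [mul_right_comm (R _ _), ← Finset.sum_mul, hrt', s, Finset.mul_sum]
      exact Finset.sum_congr rfl fun a _ => by ring
    exact mul_right_cancel₀ hs.ne' (h1.symm.trans h2)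
  subst htt
  refine ⟨fun a => l a * r a / s, ?_, ?_, ?_, ?_, ?_⟩
  · exact fun a b => div_nonneg (mul_nonneg (hR a b) (hr b).le) (mul_pos ht (hr a)).le
  · intro a
    simp only [parryMatrix, Matrix.of_apply]
    rw [← Finset.sum_div, hrt', div_self (mul_pos ht (hr a)).ne']
  · exact fun a => div_pos (mul_pos (hl a) (hr a)) hs
  · rw [← Finset.sum_div, div_self hs.ne']
  · intro b
    have : ∀ a, l a * r a / s * (R a b * r b / (t' * r a)) = R a b * l a * (r b / (s * t')) := by
      intro a
      have := (hr a).ne'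
      field_simp
    simp only [parryMatrix, Matrix.of_apply, this]
    rw [← Finset.sum_mul, hlt']
    field_simp

end Matrices

/-! ### Words, cylinders and the measures they determine -/

section Blocks

variable {A : Type*}

/-- The word of length `n` read in `x` from position `a` on. -/
def block (a : ℤ) (n : ℕ) (x : ℤ → A) : Fin n → A := fun i => x (a + (i : ℕ))

theorem block_surjective [Nonempty A] (a : ℤ) (n : ℕ) :
    Function.Surjective (block (A := A) a n) := by
  intro w
  have hinj : Function.Injective fun i : Fin n => a + ((i : ℕ) : ℤ) := fun i j h => by
    ext
    simpa using h
  exact ⟨Function.extend _ w fun _ => Classical.arbitrary A,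
    funext fun i => hinj.extend_apply _ _ i⟩

theorem block_preimage_snoc (a : ℤ) (n : ℕ) (w : Fin n → A) (b : A) :
    block a (n + 1) ⁻¹' {(Fin.snoc w b : Fin (n + 1) → A)}
      = block a n ⁻¹' {w} ∩ (fun x => x (a + n)) ⁻¹' {b} := by
  ext x
  simp only [Set.mem_preimage, Set.mem_singleton_iff, Set.mem_inter_iff, funext_iff,
    Fin.forall_fin_succ', Fin.snoc_castSucc, Fin.snoc_last]
  simp [block]

theorem block_preimage_cons (a : ℤ) (n : ℕ) (w : Fin n → A) (b : A) :
    block a (n + 1) ⁻¹' {(Fin.cons b w : Fin (n + 1) → A)}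
      = block (a + 1) n ⁻¹' {w} ∩ (fun x => x a) ⁻¹' {b} := by
  ext x
  simp only [Set.mem_preimage, Set.mem_singleton_iff, Set.mem_inter_iff, funext_iff,
    Fin.forall_fin_succ, Fin.cons_zero, Fin.cons_succ]
  simp only [block, Fin.val_zero, Nat.cast_zero, add_zero, Fin.val_succ, Nat.cast_add, Nat.cast_one,
    add_assoc, add_comm (1 : ℤ)]
  tauto

theorem block_shift (a : ℤ) (n : ℕ) (x : ℤ → A) : block a n (shift x) = block (a + 1) n x := by
  funext i
  simp only [block, SymbolicDynamics.FullShift.shift]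
  congr 1
  ring

theorem sum_snoc [Fintype A] {E : Type*} [AddCommMonoid E] (n : ℕ) (f : (Fin (n + 1) → A) → E) :
    ∑ w, f w = ∑ w : Fin n → A, ∑ b, f (Fin.snoc w b) := by
  rw [← (Fin.snocEquiv fun _ : Fin (n + 1) => A).sum_comp, Fintype.sum_prod_type, Finset.sum_comm]
  rfl

theorem sum_cons [Fintype A] {E : Type*} [AddCommMonoid E] (n : ℕ) (f : (Fin (n + 1) → A) → E) :
    ∑ w, f w = ∑ w : Fin n → A, ∑ b, f (Fin.cons b w) := by
  rw [← (Fin.consEquiv fun _ : Fin (n + 1) => A).sum_comp, Fintype.sum_prod_type, Finset.sum_comm]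
  rfl

variable [MeasurableSpace A]

@[fun_prop]
theorem measurable_block (a : ℤ) (n : ℕ) : Measurable (block (A := A) a n) :=
  measurable_pi_lambda _ fun _ => measurable_pi_apply _

theorem measurable_shift : Measurable (shift (A := A)) :=
  measurable_pi_lambda _ fun _ => measurable_pi_apply _

variable [Fintype A] [MeasurableSingletonClass A]

theorem measurableSet_block_preimage (a : ℤ) (n : ℕ) (s : Set (Fin n → A)) :
    MeasurableSet (block a n ⁻¹' s) :=
  measurable_block a n (Set.toFinite s).measurableSet

theorem sum_real_inter_fiber {Ω B : Type*} [MeasurableSpace Ω] [Fintype B] [MeasurableSpace B]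
    [MeasurableSingletonClass B] (μ : Measure Ω) [IsFiniteMeasure μ] (s : Set Ω)
    {X : Ω → B} (hX : Measurable X) : ∑ b, μ.real (s ∩ X ⁻¹' {b}) = μ.real s := by
  have := sum_measureReal_preimage_singleton (μ := μ.restrict s) Finset.univ (f := X)
    fun b _ => hX (measurableSet_singleton b)
  simp_rw [measureReal_restrict_apply (hX (measurableSet_singleton _)), Set.inter_comm _ s] at this
  simpa using this

theorem sum_snoc_real (μ : Measure (ℤ → A)) [IsFiniteMeasure μ] (a : ℤ) (n : ℕ) (w : Fin n → A) :
    ∑ b, μ.real (block a (n + 1) ⁻¹' {(Fin.snoc w b : Fin (n + 1) → A)})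
      = μ.real (block a n ⁻¹' {w}) := by
  simp_rw [block_preimage_snoc]
  exact sum_real_inter_fiber μ _ (measurable_pi_apply _)

theorem sum_cons_real (μ : Measure (ℤ → A)) [IsFiniteMeasure μ] (a : ℤ) (n : ℕ) (w : Fin n → A) :
    ∑ b, μ.real (block a (n + 1) ⁻¹' {(Fin.cons b w : Fin (n + 1) → A)})
      = μ.real (block (a + 1) n ⁻¹' {w}) := by
  simp_rw [block_preimage_cons]
  exact sum_real_inter_fiber μ _ (measurable_pi_apply _)

omit [MeasurableSpace A] [Fintype A] [MeasurableSingletonClass A] in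
theorem exists_restrict_eq_comp_block (I : Finset ℤ) : ∃ (a : ℤ) (n : ℕ)
    (g : (Fin n → A) → I → A), ∀ x : ℤ → A, I.restrict x = g (block a n x) := by
  obtain ⟨a, ha⟩ := I.bddBelow
  obtain ⟨b, hb⟩ := I.bddAbove
  have hidx : ∀ i : I, ((i : ℤ) - a).toNat < (b - a).toNat + 1 := fun i => by
    have := ha i.2
    have := hb i.2
    omega
  refine ⟨a, (b - a).toNat + 1, fun w i => w ⟨_, hidx i⟩, fun x => funext fun i => ?_⟩
  have := ha i.2
  simp only [Finset.restrict, block]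
  congr 1
  omega

/-- A finite measure on bi-infinite sequences is determined by the probabilities of words. -/
theorem ext_of_block {μ ν : Measure (ℤ → A)} [IsFiniteMeasure μ] [IsFiniteMeasure ν]
    (h : ∀ (a : ℤ) (n : ℕ) (w : Fin n → A),
      μ.real (block a n ⁻¹' {w}) = ν.real (block a n ⁻¹' {w})) :
    μ = ν := by
  have hmap : ∀ a n, μ.map (block a n) = ν.map (block a n) := fun a n =>
    Measure.ext_of_singleton fun w => by
      rw [Measure.map_apply (by fun_prop) (measurableSet_singleton w),
        Measure.map_apply (by fun_prop) (measurableSet_singleton w)]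
      exact (measureReal_eq_measureReal_iff).1 (h a n w)
  refine IsProjectiveLimit.unique (P := fun I => μ.map I.restrict) (fun I => rfl) fun I => ?_
  obtain ⟨a, n, g, hg⟩ := exists_restrict_eq_comp_block (A := A) I
  have : (I.restrict : (ℤ → A) → I → A) = g ∘ block a n := funext hg
  change ν.map I.restrict = μ.map I.restrict
  rw [this, ← Measure.map_map (measurable_of_finite g) (by fun_prop),
    ← Measure.map_map (measurable_of_finite g) (by fun_prop), hmap]

end Blocks

/-! ### Construction of the two-sided Markov chain -/

section Markov

variable {A : Type*} [Fintype A]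

/-- The probability of a word under the stationary Markov chain with transition matrix `p` and
initial distribution `π`. -/
def chainWeight (p : Matrix A A ℝ) (π : A → ℝ) {n : ℕ} (w : Fin (n + 1) → A) : ℝ :=
  π (w 0) * ∏ i : Fin n, p (w i.castSucc) (w i.succ)

omit [Fintype A] in
theorem chainWeight_snoc (p : Matrix A A ℝ) (π : A → ℝ) {n : ℕ} (w : Fin (n + 1) → A) (b : A) :
    chainWeight p π (Fin.snoc w b : Fin (n + 2) → A)
      = chainWeight p π w * p (w (Fin.last n)) b := by
  have h0 : (Fin.snoc w b : Fin (n + 2) → A) 0 = w 0 := Fin.snoc_castSucc (α := fun _ => A) b w 0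
  have hs : ∀ i : Fin n, (Fin.snoc w b : Fin (n + 2) → A) i.castSucc.succ = w i.succ := fun i =>
    Fin.snoc_castSucc (α := fun _ => A) b w i.succ
  simp only [chainWeight, Fin.prod_univ_castSucc (n := n), h0, hs, Fin.snoc_castSucc,
    Fin.succ_last, Fin.snoc_last, mul_assoc]

theorem IsStationaryChain.sum_snoc {p : Matrix A A ℝ} {π : A → ℝ} (h : IsStationaryChain p π)
    {n : ℕ} (w : Fin (n + 1) → A) :
    ∑ b, chainWeight p π (Fin.snoc w b : Fin (n + 2) → A) = chainWeight p π w := by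
  simp_rw [chainWeight_snoc, ← Finset.mul_sum, h.sum_row, mul_one]

theorem IsStationaryChain.sum_cons {p : Matrix A A ℝ} {π : A → ℝ} (h : IsStationaryChain p π)
    {n : ℕ} (w : Fin (n + 1) → A) :
    ∑ b, chainWeight p π (Fin.cons b w : Fin (n + 2) → A) = chainWeight p π w := by
  simp only [chainWeight, Fin.prod_univ_succ (n := n), Fin.cons_zero, Fin.cons_succ,
    Fin.castSucc_zero, ← Fin.succ_castSucc]
  simp_rw [← mul_assoc, ← Finset.sum_mul, h.stationary]

theorem IsStationaryChain.sum_chainWeight {p : Matrix A A ℝ} {π : A → ℝ}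
    (h : IsStationaryChain p π) (n : ℕ) : ∑ w : Fin (n + 1) → A, chainWeight p π w = 1 := by
  induction n with
  | zero =>
    rw [← h.sum_init, ← (Equiv.funUnique (Fin 1) A).symm.sum_comp]
    simp [chainWeight]
  | succ n ih =>
    rw [PIJ.sum_snoc]
    simp_rw [h.sum_snoc, ih]

theorem IsStationaryChain.chainWeight_nonneg {p : Matrix A A ℝ} {π : A → ℝ}
    (h : IsStationaryChain p π) {n : ℕ} (w : Fin (n + 1) → A) : 0 ≤ chainWeight p π w :=
  mul_nonneg (h.init_pos _).le (Finset.prod_nonneg fun _ _ => h.nonneg _ _)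

variable [MeasurableSpace A] [MeasurableSingletonClass A]

/-- Words of length `n + 1` read from position `a` on have the law of the Markov chain. -/
def HasChainLaw (p : Matrix A A ℝ) (π : A → ℝ) (μ : Measure (ℤ → A)) (a : ℤ) (n : ℕ) : Prop :=
  ∀ w : Fin (n + 1) → A, μ.real (block a (n + 1) ⁻¹' {w}) = chainWeight p π w

variable {p : Matrix A A ℝ} {π : A → ℝ} {μ : Measure (ℤ → A)}

theorem HasChainLaw.of_add_right [IsFiniteMeasure μ] (h : IsStationaryChain p π) {a : ℤ} {n k : ℕ}
    (hμ : HasChainLaw p π μ a (n + k)) : HasChainLaw p π μ a n := by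
  induction k with
  | zero => exact hμ
  | succ k ih =>
    refine ih fun w => ?_
    rw [← sum_snoc_real, ← h.sum_snoc]
    exact Finset.sum_congr rfl fun b _ => hμ _

/-- Deleting first letters is where stationarity of `π` is needed; deleting last letters only needs
the rows of `p` to sum to 1. -/
theorem HasChainLaw.of_add_left [IsFiniteMeasure μ] (h : IsStationaryChain p π) {a : ℤ} {n k : ℕ}
    (hμ : HasChainLaw p π μ a (n + k)) : HasChainLaw p π μ (a + k) n := by
  induction k generalizing a with
  | zero => simpa using hμ
  | succ k ih =>
    have : HasChainLaw p π μ (a + 1) (n + k) := fun w => by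
      rw [← sum_cons_real, ← h.sum_cons]
      exact Finset.sum_congr rfl fun b _ => hμ _
    have := ih this
    rwa [add_assoc, add_comm 1, ← Nat.cast_one, ← Nat.cast_add] at this

theorem exists_hasChainLaw (h : IsStationaryChain p π) (a : ℤ) (n : ℕ) :
    ∃ ρ : Measure (ℤ → A), IsProbabilityMeasure ρ ∧ HasChainLaw p π ρ a n := by
  have hne : Nonempty A := by
    by_contra hA
    rw [not_nonempty_iff] at hA
    simpa using h.sum_init
  choose e he using block_surjective (A := A) a (n + 1)
  let ρ : Measure (ℤ → A) :=
    ∑ w : Fin (n + 1) → A, ENNReal.ofReal (chainWeight p π w) • Measure.dirac (e w)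
  have hρ : ∀ s, MeasurableSet s →
      ρ s = ∑ w, ENNReal.ofReal (chainWeight p π w) * s.indicator 1 (e w) := fun s hs => by
    simp [ρ, Measure.dirac_apply' _ hs]
  refine ⟨ρ, ⟨?_⟩, fun w => ?_⟩
  · rw [hρ _ .univ]
    simp only [Set.indicator_univ, Pi.one_apply, mul_one]
    rw [← ENNReal.ofReal_sum_of_nonneg fun w _ => h.chainWeight_nonneg w, h.sum_chainWeight,
      ENNReal.ofReal_one]
  · classical
    rw [measureReal_def, hρ _ (measurableSet_block_preimage _ _ _)]
    simp only [Set.indicator_apply, Set.mem_preimage, he, Set.mem_singleton_iff]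
    simp [h.chainWeight_nonneg]

variable [TopologicalSpace A] [DiscreteTopology A]

/-- The two-sided stationary Markov chain. -/
theorem exists_markov (h : IsStationaryChain p π) :
    ∃ ν : Measure (ℤ → A), IsProbabilityMeasure ν ∧ MeasurePreserving shift ν ν ∧
      ∀ a n, HasChainLaw p π ν a n := by
  have : BorelSpace A := by
    constructor
    rw [borel_eq_top_of_discrete]
    exact eq_top_iff.2 fun s _ => (Set.toFinite s).measurableSet
  have := TopologicalSpace.metrizableSpace_of_t3_secondCountable (ℤ → A)
  let _ := TopologicalSpace.metrizableSpaceMetric (ℤ → A)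
  choose ρ hρP hρ using fun N : ℕ => exists_hasChainLaw h (-(N : ℤ)) (2 * N)
  let ρ' : ℕ → ProbabilityMeasure (ℤ → A) := fun N => ⟨ρ N, hρP N⟩
  -- The chain is an ultrafilter limit in the compact space of probability measures. Cylinders are
  -- clopen, so their measures pass to the limit, and under `ρ N` they are eventually constant.
  obtain ⟨ν, -, hν⟩ := isCompact_univ.ultrafilter_le_nhds
    ((hyperfilter ℕ).map ρ') (by simp)
  have hlaw : ∀ a n, HasChainLaw p π (ν : Measure (ℤ → A)) a n := by
    intro a n w
    have hclopen : IsClopen (block a (n + 1) ⁻¹' {w}) :=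
      (isClopen_discrete {w}).preimage (continuous_pi fun _ => continuous_apply _)
    have h1 := ProbabilityMeasure.tendsto_measure_of_isClopen_of_tendsto
      (L := (hyperfilter ℕ : Filter ℕ)) (μs := ρ') hν hclopen
    have h2 := (NNReal.tendsto_coe.2 h1)
    have h3 : ∀ᶠ N : ℕ in (hyperfilter ℕ : Filter ℕ),
        ((ρ' N (block a (n + 1) ⁻¹' {w}) : NNReal) : ℝ) = chainWeight p π w := by
      have hle : (hyperfilter ℕ : Filter ℕ) ≤ atTop := Nat.hyperfilter_le_atTop
      filter_upwards [hle (eventually_ge_atTop (a.natAbs + n))] with N hN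
      have h4 : HasChainLaw p π (ρ N) (-(N : ℤ)) ((N - a).toNat + (a + N).toNat) := by
        convert hρ N using 1
        omega
      have h5 := h4.of_add_left h
      rw [show -(N : ℤ) + ((a + N).toNat : ℕ) = a by omega,
        show (N - a).toNat = n + ((N - a).toNat - n) by omega] at h5
      exact h5.of_add_right h w
    exact tendsto_nhds_unique h2 (tendsto_const_nhds.congr' (h3.mono fun _ hN => hN.symm))
  refine ⟨ν, inferInstance, ⟨measurable_shift, ?_⟩, hlaw⟩
  have := Measure.isProbabilityMeasure_map (μ := (ν : Measure (ℤ → A)))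
    (measurable_shift (A := A)).aemeasurable
  refine ext_of_block fun a n w => ?_
  rw [map_measureReal_apply measurable_shift (measurableSet_block_preimage _ _ _)]
  have : shift ⁻¹' (block a n ⁻¹' {w}) = block (a + 1) n ⁻¹' {w} := by
    ext x
    simp [block_shift]
  rw [this]
  cases n with
  | zero =>
    congr 1
    ext x
    simp [eq_iff_true_of_subsingleton]
  | succ n => rw [hlaw, hlaw]

end Markov

/-! ### Gibbs' inequality and its equality case -/

section Gibbs

/-- This is `log z ≤ z - 1` at `z = y / x`, multiplied by `x`. -/
theorem negMulLog_add_mul_log_le {x y : ℝ} (hx : 0 ≤ x) (hy : 0 ≤ y) (hxy : 0 < x → 0 < y) :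
    Real.negMulLog x + x * Real.log y ≤ y - x := by
  rcases hx.eq_or_lt' with rfl | hx
  · simpa using hy
  · have h := Real.log_le_sub_one_of_pos (div_pos (hxy hx) hx)
    rw [Real.log_div (hxy hx).ne' hx.ne'] at h
    have := mul_le_mul_of_nonneg_left h hx.le
    rw [mul_sub x (y / x), mul_div_cancel₀ _ hx.ne'] at this
    rw [Real.negMulLog]
    linarith

theorem eq_of_negMulLog_add_mul_log_eq {x y : ℝ} (hx : 0 ≤ x) (hxy : 0 < x → 0 < y)
    (h : Real.negMulLog x + x * Real.log y = y - x) : x = y := by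
  rcases hx.eq_or_lt' with rfl | hx
  · simpa using h
  · by_contra hne
    have h' := Real.log_lt_sub_one_of_pos (div_pos (hxy hx) hx)
      (fun h1 => hne (by rwa [div_eq_one_iff_eq hx.ne', eq_comm] at h1))
    rw [Real.log_div (hxy hx).ne' hx.ne'] at h'
    have := mul_lt_mul_of_pos_left h' hx
    rw [mul_sub x (y / x), mul_div_cancel₀ _ hx.ne'] at this
    rw [Real.negMulLog] at h
    linarith

variable {I : Type*} [Fintype I] {P Q : I → ℝ}

theorem gibbs_le (hP : ∀ i, 0 ≤ P i) (hQ : ∀ i, 0 ≤ Q i) (hPQ : ∀ i, 0 < P i → 0 < Q i)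
    (hsum : ∑ i, Q i ≤ ∑ i, P i) :
    ∑ i, Real.negMulLog (P i) ≤ -∑ i, P i * Real.log (Q i) := by
  have := Finset.sum_le_sum fun i (_ : i ∈ Finset.univ) =>
    negMulLog_add_mul_log_le (hP i) (hQ i) (hPQ i)
  rw [Finset.sum_add_distrib, Finset.sum_sub_distrib] at this
  linarith

theorem eq_of_gibbs_eq (hP : ∀ i, 0 ≤ P i) (hQ : ∀ i, 0 ≤ Q i) (hPQ : ∀ i, 0 < P i → 0 < Q i)
    (hsum : ∑ i, Q i ≤ ∑ i, P i)
    (h : -∑ i, P i * Real.log (Q i) ≤ ∑ i, Real.negMulLog (P i)) (i : I) : P i = Q i := by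
  have hle := fun i (_ : i ∈ Finset.univ) => negMulLog_add_mul_log_le (hP i) (hQ i) (hPQ i)
  have heq : ∑ i, (Real.negMulLog (P i) + P i * Real.log (Q i)) = ∑ i, (Q i - P i) := by
    refine le_antisymm (Finset.sum_le_sum hle) ?_
    rw [Finset.sum_add_distrib, Finset.sum_sub_distrib]
    linarith
  exact eq_of_negMulLog_add_mul_log_eq (hP i) (hPQ i)
    ((Finset.sum_eq_sum_iff_of_le hle).1 heq i (Finset.mem_univ i))

end Gibbs

/-! ### Growth rate of concave sequences -/

section Increments

variable {H : ℕ → ℝ}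

theorem le_add_mul_of_concave (hH : ∀ n, H (n + 2) - H (n + 1) ≤ H (n + 1) - H n) (m j : ℕ) :
    H (m + j) ≤ H m + j * (H (m + 1) - H m) := by
  have hanti : Antitone fun n => H (n + 1) - H n := antitone_nat_of_succ_le hH
  induction j with
  | zero => simp
  | succ j ih =>
    have := hanti (Nat.le_add_right m j)
    simp only at this
    rw [← add_assoc]
    push_cast
    linarith

theorem tendsto_const_add_div (c d : ℝ) :
    Tendsto (fun n : ℕ => (d + n * c) / (n : ℝ)) atTop (nhds c) := by
  have h := (tendsto_const_div_atTop_nhds_zero_nat d).add_const c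
  rw [zero_add] at h
  refine h.congr' ?_
  filter_upwards [eventually_gt_atTop 0] with n hn
  have : (n : ℝ) ≠ 0 := by positivity
  field_simp

/-- From `m` on, a concave `H` stays below the line whose slope is its increment at `m`. -/
theorem limsup_div_le_increment (hH : ∀ n, H (n + 2) - H (n + 1) ≤ H (n + 1) - H n)
    (h0 : ∀ n, 0 ≤ H n) (m : ℕ) : limsup (fun n : ℕ => H n / n) atTop ≤ H (m + 1) - H m := by
  set d := H (m + 1) - H m
  have hlim := tendsto_const_add_div d (H m - m * d)
  rw [← hlim.limsup_eq]
  refine limsup_le_limsup ?_ ?_ hlim.isBoundedUnder_le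
  · filter_upwards [eventually_ge_atTop m] with n hn
    obtain ⟨j, rfl⟩ := Nat.exists_eq_add_of_le hn
    refine div_le_div_of_nonneg_right ?_ (Nat.cast_nonneg _)
    have := le_add_mul_of_concave hH m j
    push_cast
    linarith
  · exact IsCoboundedUnder.of_frequently_ge (a := 0)
      (Frequently.of_forall fun n => div_nonneg (h0 n) (Nat.cast_nonneg n))

theorem le_limsup_div (hH : ∀ n, H (n + 2) - H (n + 1) ≤ H (n + 1) - H n) {c C : ℝ}
    (h : ∀ n : ℕ, n * c - C ≤ H n) : c ≤ limsup (fun n : ℕ => H n / n) atTop := by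
  have hlim := tendsto_const_add_div c (-C)
  rw [← hlim.limsup_eq]
  have hup := tendsto_const_add_div (H 1 - H 0) (H 0)
  refine limsup_le_limsup (Eventually.of_forall fun n => ?_) hlim.isCoboundedUnder_le
    (hup.isBoundedUnder_le.mono_le (Eventually.of_forall fun n => ?_))
  · refine div_le_div_of_nonneg_right ?_ (Nat.cast_nonneg _)
    linarith [h n]
  · refine div_le_div_of_nonneg_right ?_ (Nat.cast_nonneg _)
    simpa using le_add_mul_of_concave hH 0 n

end Increments

/-! ### Block entropies of a stationary process -/

section Entropy

variable {A : Type*} [MeasurableSpace A]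

/-- The probability of the word `w`. -/
noncomputable def wordProb (μ : Measure (ℤ → A)) {n : ℕ} (w : Fin n → A) : ℝ :=
  μ.real (block 0 n ⁻¹' {w})

variable [Fintype A] [MeasurableSingletonClass A] {μ : Measure (ℤ → A)}

omit [Fintype A] [MeasurableSingletonClass A] in
theorem wordProb_nonneg {n : ℕ} (w : Fin n → A) : 0 ≤ wordProb μ w := measureReal_nonneg

omit [MeasurableSingletonClass A] in
theorem blockEntropy_eq (μ : Measure (ℤ → A)) (n : ℕ) :
    blockEntropy μ n = ∑ w : Fin n → A, Real.negMulLog (wordProb μ w) := by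
  refine Finset.sum_congr rfl fun w _ => ?_
  congr 3
  ext x
  simp [block, funext_iff]

theorem real_block_eq_wordProb (hμ : MeasurePreserving shift μ μ) (a : ℤ) {n : ℕ}
    (w : Fin n → A) : μ.real (block a n ⁻¹' {w}) = wordProb μ w := by
  have hstep : ∀ a : ℤ, μ.real (block (a + 1) n ⁻¹' {w}) = μ.real (block a n ⁻¹' {w}) := by
    intro a
    rw [← hμ.measureReal_preimage (measurableSet_block_preimage a n {w}).nullMeasurableSet]
    congr 1
    ext x
    simp [block_shift]
  induction a using Int.induction_on with
  | zero => rfl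
  | succ a ih => rw [hstep, ih]
  | pred a ih => rw [← hstep, sub_add_cancel, ih]

theorem sum_wordProb_snoc [IsFiniteMeasure μ] {n : ℕ} (w : Fin n → A) :
    ∑ b, wordProb μ (Fin.snoc w b : Fin (n + 1) → A) = wordProb μ w :=
  sum_snoc_real μ 0 n w

theorem sum_wordProb_cons [IsFiniteMeasure μ] (hμ : MeasurePreserving shift μ μ) {n : ℕ}
    (w : Fin n → A) : ∑ b, wordProb μ (Fin.cons b w : Fin (n + 1) → A) = wordProb μ w :=
  (sum_cons_real μ 0 n w).trans (real_block_eq_wordProb hμ _ w)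

theorem sum_wordProb [IsProbabilityMeasure μ] (n : ℕ) : ∑ w : Fin n → A, wordProb μ w = 1 := by
  simpa [wordProb] using sum_real_inter_fiber μ Set.univ (measurable_block (A := A) 0 n)

omit [Fintype A] [MeasurableSingletonClass A] in
theorem wordProb_le_one [IsProbabilityMeasure μ] {n : ℕ} (w : Fin n → A) : wordProb μ w ≤ 1 :=
  measureReal_le_one

omit [MeasurableSingletonClass A] in
theorem blockEntropy_nonneg [IsProbabilityMeasure μ] (n : ℕ) : 0 ≤ blockEntropy μ n := by
  rw [blockEntropy_eq]
  exact Finset.sum_nonneg fun w _ => Real.negMulLog_nonneg (wordProb_nonneg w) (wordProb_le_one w)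

theorem wordProb_pos_of_snoc [IsFiniteMeasure μ] {n : ℕ} {w : Fin n → A} {b : A}
    (h : 0 < wordProb μ (Fin.snoc w b : Fin (n + 1) → A)) : 0 < wordProb μ w := by
  rw [← sum_wordProb_snoc]
  exact Finset.sum_pos' (fun _ _ => wordProb_nonneg _) ⟨b, Finset.mem_univ b, h⟩

section Conditional

variable [IsProbabilityMeasure μ] {n : ℕ} {K : (Fin n → A) → A → ℝ}

theorem sum_wordProb_mul_le (hK' : ∀ w, ∑ b, K w b ≤ 1) :
    ∑ q : (Fin n → A) × A, wordProb μ q.1 * K q.1 q.2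
      ≤ ∑ q : (Fin n → A) × A, wordProb μ (Fin.snoc q.1 q.2 : Fin (n + 1) → A) := by
  simp_rw [Fintype.sum_prod_type, sum_wordProb_snoc, ← Finset.mul_sum]
  exact Finset.sum_le_sum fun w _ => mul_le_of_le_one_right (wordProb_nonneg w) (hK' w)

theorem sum_wordProb_mul_log
    (hpos : ∀ w b, 0 < wordProb μ (Fin.snoc w b : Fin (n + 1) → A) → 0 < K w b) :
    ∑ q : (Fin n → A) × A,
      wordProb μ (Fin.snoc q.1 q.2 : Fin (n + 1) → A) * Real.log (wordProb μ q.1 * K q.1 q.2)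
      = -blockEntropy μ n
        + ∑ w, ∑ b, wordProb μ (Fin.snoc w b : Fin (n + 1) → A) * Real.log (K w b) := by
  have : ∀ w b, wordProb μ (Fin.snoc w b : Fin (n + 1) → A) * Real.log (wordProb μ w * K w b)
      = wordProb μ (Fin.snoc w b : Fin (n + 1) → A) * Real.log (wordProb μ w)
        + wordProb μ (Fin.snoc w b : Fin (n + 1) → A) * Real.log (K w b) := by
    intro w b
    rcases (wordProb_nonneg (μ := μ) (Fin.snoc w b : Fin (n + 1) → A)).eq_or_lt' with h | h
    · simp [h]
    · rw [Real.log_mul (wordProb_pos_of_snoc h).ne' (hpos w b h).ne', mul_add]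
  simp_rw [Fintype.sum_prod_type, this, Finset.sum_add_distrib, ← Finset.sum_mul,
    sum_wordProb_snoc, blockEntropy_eq, Real.negMulLog, neg_mul, Finset.sum_neg_distrib, neg_neg]

omit [MeasurableSingletonClass A] in
theorem blockEntropy_succ_eq (μ : Measure (ℤ → A)) (n : ℕ) :
    blockEntropy μ (n + 1) = ∑ q : (Fin n → A) × A,
      Real.negMulLog (wordProb μ (Fin.snoc q.1 q.2 : Fin (n + 1) → A)) := by
  rw [blockEntropy_eq, sum_snoc, Fintype.sum_prod_type]

/-- Gibbs' inequality for the conditional distribution of a symbol given the word before it. -/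
theorem blockEntropy_succ_le (hK : ∀ w b, 0 ≤ K w b) (hK' : ∀ w, ∑ b, K w b ≤ 1)
    (hpos : ∀ w b, 0 < wordProb μ (Fin.snoc w b : Fin (n + 1) → A) → 0 < K w b) :
    blockEntropy μ (n + 1) ≤ blockEntropy μ n
      - ∑ w, ∑ b, wordProb μ (Fin.snoc w b : Fin (n + 1) → A) * Real.log (K w b) := by
  have := gibbs_le (P := fun q : (Fin n → A) × A => wordProb μ (Fin.snoc q.1 q.2 : Fin (n + 1) → A))
    (Q := fun q => wordProb μ q.1 * K q.1 q.2) (fun q => wordProb_nonneg _)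
    (fun q => mul_nonneg (wordProb_nonneg _) (hK _ _))
    (fun q hq => mul_pos (wordProb_pos_of_snoc hq) (hpos _ _ hq)) (sum_wordProb_mul_le hK')
  rw [sum_wordProb_mul_log hpos, ← blockEntropy_succ_eq] at this
  linarith

/-- The equality case of Gibbs' inequality, through which maximal entropy determines the transition
probabilities. -/
theorem wordProb_snoc_eq_of_entropy_le (hK : ∀ w b, 0 ≤ K w b) (hK' : ∀ w, ∑ b, K w b ≤ 1)
    (hpos : ∀ w b, 0 < wordProb μ (Fin.snoc w b : Fin (n + 1) → A) → 0 < K w b)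
    (h : blockEntropy μ n
      - ∑ w, ∑ b, wordProb μ (Fin.snoc w b : Fin (n + 1) → A) * Real.log (K w b)
        ≤ blockEntropy μ (n + 1)) (w : Fin n → A) (b : A) :
    wordProb μ (Fin.snoc w b : Fin (n + 1) → A) = wordProb μ w * K w b := by
  refine eq_of_gibbs_eq
    (P := fun q : (Fin n → A) × A => wordProb μ (Fin.snoc q.1 q.2 : Fin (n + 1) → A))
    (Q := fun q => wordProb μ q.1 * K q.1 q.2) (fun q => wordProb_nonneg _)
    (fun q => mul_nonneg (wordProb_nonneg _) (hK _ _))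
    (fun q hq => mul_pos (wordProb_pos_of_snoc hq) (hpos _ _ hq)) (sum_wordProb_mul_le hK') ?_
    (w, b)
  rw [sum_wordProb_mul_log hpos, ← blockEntropy_succ_eq]
  linarith

end Conditional

/-- By stationarity the last letter and the one before it have the same law. This cancels the
eigenvector terms when Gibbs' inequality is applied with the Parry kernel. -/
theorem sum_snoc_mul_last [IsFiniteMeasure μ] (hμ : MeasurePreserving shift μ μ) (g : A → ℝ)
    (n : ℕ) :
    ∑ w : Fin (n + 1) → A, ∑ b, wordProb μ (Fin.snoc w b : Fin (n + 2) → A) * g b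
      = ∑ w : Fin (n + 1) → A, ∑ b,
          wordProb μ (Fin.snoc w b : Fin (n + 2) → A) * g (w (Fin.last n)) := by
  have h1 := sum_snoc (n + 1) fun w : Fin (n + 2) → A => wordProb μ w * g (w (Fin.last _))
  have h2 := sum_cons (n + 1) fun w : Fin (n + 2) → A => wordProb μ w * g (w (Fin.last _))
  simp only [Fin.snoc_last] at h1
  simp only [← Fin.succ_last, Fin.cons_succ, ← Finset.sum_mul, sum_wordProb_cons hμ] at h2
  rw [← h1, ← Fin.succ_last, h2]
  simp_rw [← Finset.sum_mul, sum_wordProb_snoc]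

/-- Strong subadditivity: the increments of the block entropies decrease. -/
theorem blockEntropy_concave [IsProbabilityMeasure μ] (hμ : MeasurePreserving shift μ μ) (n : ℕ) :
    blockEntropy μ (n + 2) - blockEntropy μ (n + 1)
      ≤ blockEntropy μ (n + 1) - blockEntropy μ n := by
  -- `K` predicts the next symbol while ignoring the first letter, which can only raise the entropy.
  -- Where `Fin.tail w` is null, division by zero makes the row of `K` vanish, so rows sum to at
  -- most 1 rather than to 1.
  let K : (Fin (n + 1) → A) → A → ℝ := fun w b =>
    wordProb μ (Fin.snoc (Fin.tail w) b : Fin (n + 1) → A) / wordProb μ (Fin.tail w)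
  have hpos : ∀ w b, 0 < wordProb μ (Fin.snoc w b : Fin (n + 2) → A) → 0 < K w b := by
    intro w b h
    have h1 : 0 < wordProb μ (Fin.snoc (Fin.tail w) b : Fin (n + 1) → A) := by
      rw [← sum_wordProb_cons hμ]
      refine Finset.sum_pos' (fun _ _ => wordProb_nonneg _) ⟨w 0, Finset.mem_univ _, ?_⟩
      rwa [Fin.cons_snoc_eq_snoc_cons, Fin.cons_self_tail]
    exact div_pos h1 (wordProb_pos_of_snoc h1)
  have key := blockEntropy_succ_le (μ := μ) (K := K)
    (fun w b => div_nonneg (wordProb_nonneg _) (wordProb_nonneg _))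
    (fun w => by rw [← Finset.sum_div, sum_wordProb_snoc]; exact div_self_le_one _) hpos
  have hlog : ∀ (v : Fin n → A) (b : A),
      wordProb μ (Fin.snoc v b : Fin (n + 1) → A)
        * Real.log (wordProb μ (Fin.snoc v b : Fin (n + 1) → A) / wordProb μ v)
      = -Real.negMulLog (wordProb μ (Fin.snoc v b : Fin (n + 1) → A))
        - wordProb μ (Fin.snoc v b : Fin (n + 1) → A) * Real.log (wordProb μ v) := by
    intro v b
    rcases (wordProb_nonneg (μ := μ) (Fin.snoc v b : Fin (n + 1) → A)).eq_or_lt' with h | h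
    · simp [h]
    · rw [Real.log_div h.ne' (wordProb_pos_of_snoc h).ne', Real.negMulLog]
      ring
  have hsum : ∑ w, ∑ b, wordProb μ (Fin.snoc w b : Fin (n + 2) → A) * Real.log (K w b)
      = -blockEntropy μ (n + 1) + blockEntropy μ n := by
    rw [sum_cons n]
    simp only [K, Fin.tail_cons, ← Fin.cons_snoc_eq_snoc_cons]
    have : ∀ v : Fin n → A, ∑ c, ∑ b,
        wordProb μ (Fin.cons c (Fin.snoc v b : Fin (n + 1) → A) : Fin (n + 2) → A)
          * Real.log (wordProb μ (Fin.snoc v b : Fin (n + 1) → A) / wordProb μ v)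
        = ∑ b, (-Real.negMulLog (wordProb μ (Fin.snoc v b : Fin (n + 1) → A))
          - wordProb μ (Fin.snoc v b : Fin (n + 1) → A) * Real.log (wordProb μ v)) := by
      intro v
      rw [Finset.sum_comm]
      simp_rw [← Finset.sum_mul, sum_wordProb_cons hμ, hlog]
    simp_rw [this, Finset.sum_sub_distrib, ← Finset.sum_mul, sum_wordProb_snoc, blockEntropy_eq,
      sum_snoc n, Real.negMulLog, neg_mul, Finset.sum_neg_distrib]
    ring
  rw [hsum] at key
  linarith

theorem entropy_le_increment [IsProbabilityMeasure μ] (hμ : MeasurePreserving shift μ μ) (n : ℕ) :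
    entropy μ ≤ blockEntropy μ (n + 1) - blockEntropy μ n :=
  limsup_div_le_increment (blockEntropy_concave hμ) blockEntropy_nonneg n

end Entropy

/-! ### Transition probabilities of the measure of maximal entropy -/

section MaxEntropy

variable {A : Type*} [Fintype A] [DecidableEq A]

theorem intCast_map_pow (M : Matrix A A ℤ) (k : ℕ) :
    (M.map (Int.cast : ℤ → ℝ)) ^ k = (M ^ k).map Int.cast :=
  (map_pow (Int.castRingHom ℝ).mapMatrix M k).symm

omit [DecidableEq A] in
-- Along a path the ratios of values of `r` telescope and each step contributes `1 / t`. A word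
-- using a missing edge has weight 0, whence an inequality.
theorem IsStationaryChain.chainWeight_parry_le {M : Matrix A A ℤ}
    (h01 : ∀ a b, M a b = 0 ∨ M a b = 1)
    {t : ℝ} {r π : A → ℝ} (ht : 0 < t) (hr : ∀ a, 0 < r a)
    (h : IsStationaryChain (parryMatrix (M.map Int.cast) t r) π) {n : ℕ} (w : Fin (n + 1) → A) :
    chainWeight (parryMatrix (M.map Int.cast) t r) π w
      ≤ π (w 0) / r (w 0) * r (w (Fin.last n)) * (t ^ n)⁻¹ := by
  induction n with
  | zero => simp [chainWeight, (hr _).ne']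
  | succ n ih =>
    rw [← Fin.snoc_init_self w, chainWeight_snoc]
    have h1 := ih (Fin.init w)
    have h0 : (Fin.snoc (Fin.init w) (w (Fin.last _)) : Fin (n + 2) → A) 0 = Fin.init w 0 :=
      Fin.snoc_castSucc (α := fun _ => A) _ _ 0
    rw [h0, Fin.snoc_last]
    set a := Fin.init w (Fin.last n)
    set b := w (Fin.last (n + 1))
    have hp : parryMatrix (M.map Int.cast) t r a b ≤ r b / (t * r a) := by
      rw [parryMatrix, Matrix.of_apply, Matrix.map_apply]
      refine div_le_div_of_nonneg_right ?_ (mul_pos ht (hr a)).le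
      rcases h01 a b with h | h <;> simp [h, (hr b).le]
    refine (mul_le_mul h1 hp (h.nonneg a b) ?_).trans_eq ?_
    · have := (hr (Fin.init w 0)).le
      have := (hr a).le
      have := (h.init_pos (Fin.init w 0)).le
      positivity
    · have := (hr a).ne'
      field_simp
      ring

variable [MeasurableSpace A] [MeasurableSingletonClass A]

omit [DecidableEq A] in
theorem le_blockEntropy_of_wordProb_le {ν : Measure (ℤ → A)} [IsProbabilityMeasure ν] {n : ℕ}
    {C : ℝ}
    (h : ∀ w : Fin n → A, wordProb ν w ≤ Real.exp (-C)) : C ≤ blockEntropy ν n := by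
  rw [blockEntropy_eq]
  calc C = ∑ w : Fin n → A, wordProb ν w * C := by rw [← Finset.sum_mul, sum_wordProb, one_mul]
    _ ≤ _ := Finset.sum_le_sum fun w _ => by
      rcases (wordProb_nonneg (μ := ν) w).eq_or_lt' with h0 | h0
      · simp [h0]
      · have := (Real.log_le_iff_le_exp h0).2 (h w)
        rw [Real.negMulLog]
        nlinarith

omit [Fintype A] [DecidableEq A] [MeasurableSingletonClass A] in
theorem wordProb_snoc_eq_zero {M : Matrix A A ℤ} {μ : Measure (ℤ → A)}
    (hμ : ∀ᵐ x ∂μ, x ∈ subshift M) {n : ℕ} {w : Fin (n + 1) → A} {b : A}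
    (h : M (w (Fin.last n)) b ≠ 1) : wordProb μ (Fin.snoc w b : Fin (n + 2) → A) = 0 := by
  rw [wordProb, measureReal_def, measure_mono_null (t := {x | x ∉ subshift M}) ?_ hμ,
    ENNReal.toReal_zero]
  intro x hx hx'
  rw [block_preimage_snoc] at hx
  obtain ⟨rfl, rfl⟩ := hx
  refine h ?_
  convert hx' n using 2 <;> simp [block]

variable [TopologicalSpace A] [DiscreteTopology A] {M : Matrix A A ℤ} {μ : Measure (ℤ → A)}
  {t : ℝ} {r : A → ℝ}

/-- The subshift carries an invariant measure whose entropy is at least `log t`, where `t` is the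
Perron eigenvalue. -/
theorem exists_log_le_entropy [Nonempty A] (h01 : ∀ a b, M a b = 0 ∨ M a b = 1)
    (hirr : M.IsIrreducible) (hap : IsAperiodic M) (ht : 0 < t) (hr : ∀ a, 0 < r a)
    (hrt : (M.map (Int.cast : ℤ → ℝ)).mulVec r = t • r) :
    ∃ ν, IsInvariantProbOn (subshift M) ν ∧ Real.log t ≤ entropy ν := by
  obtain ⟨N, hN⟩ := (eventually_pow_pos hirr hap).exists_forall_of_atTop
  obtain ⟨π, hπ⟩ := exists_parry (R := M.map (Int.cast : ℤ → ℝ)) (N := N + 1)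
    (fun a b => by simpa using hirr.nonneg a b) (by simp)
    (fun a b => by rw [intCast_map_pow]; simpa using hN (N + 1) (by simp) a b) ht hr hrt
  obtain ⟨ν, hνP, hνs, hν⟩ := exists_markov hπ
  refine ⟨ν, ⟨hνP, hνs, ?_⟩, ?_⟩
  · refine ae_all_iff.2 fun i => ?_
    have hnull : ∀ q : A × A, M q.1 q.2 ≠ 1 → ∀ᵐ x ∂ν, ¬ (x i = q.1 ∧ x (i + 1) = q.2) := by
      intro q hq
      have h0 : M q.1 q.2 = 0 := (h01 _ _).resolve_right hq
      have h1 := hν i 1 ![q.1, q.2]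
      simp only [chainWeight, Finset.univ_unique, Finset.prod_singleton] at h1
      rw [measureReal_def] at h1
      have h2 : ν (block i 2 ⁻¹' {![q.1, q.2]}) = 0 := by
        refine (ENNReal.toReal_eq_zero_iff _).1 ?_ |>.resolve_right (measure_ne_top _ _)
        simpa [parryMatrix, h0] using h1
      rw [ae_iff]
      refine measure_mono_null (fun x hx => ?_) h2
      have hx := not_not.1 hx
      ext j
      fin_cases j <;> simp [block, hx]
    have hall : ∀ᵐ x ∂ν, ∀ q : A × A, M q.1 q.2 ≠ 1 → ¬ (x i = q.1 ∧ x (i + 1) = q.2) := by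
      refine ae_all_iff.2 fun q => ?_
      by_cases hq : M q.1 q.2 = 1
      · exact ae_of_all _ fun x h => absurd hq h
      · filter_upwards [hnull q hq] with x hx _ using hx
    filter_upwards [hall] with x hx
    by_contra hcon
    exact hx (x i, x (i + 1)) hcon ⟨rfl, rfl⟩
  -- `B` bounds the logarithm of the boundary factor left by telescoping, over the finitely many
  -- pairs of end letters.
  · obtain ⟨B, hB⟩ : ∃ B : ℝ, ∀ q : A × A, Real.log (π q.1 / r q.1 * r q.2) ≤ B :=
      (Set.finite_range _).bddAbove.imp fun B hB q => hB ⟨q, rfl⟩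
    have hword : ∀ (n : ℕ) (w : Fin (n + 1) → A),
        wordProb ν w ≤ Real.exp (-(n * Real.log t - B)) := by
      intro n w
      rw [wordProb, hν 0 n w]
      refine (hπ.chainWeight_parry_le h01 ht hr w).trans ?_
      have h1 : 0 < π (w 0) / r (w 0) * r (w (Fin.last n)) :=
        mul_pos (div_pos (hπ.init_pos _) (hr _)) (hr _)
      rw [neg_sub, Real.exp_sub, ← Real.log_pow, Real.exp_log (pow_pos ht n), div_eq_mul_inv]
      exact mul_le_mul_of_nonneg_right ((Real.log_le_iff_le_exp h1).1 (hB (w 0, w (Fin.last n))))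
        (inv_nonneg.2 (pow_pos ht n).le)
    -- A word of `n + 1` letters has `n` transitions: `|log t|` absorbs the missing one, and `|B|`
    -- covers length 0.
    have hlow : ∀ n : ℕ, (n : ℝ) * Real.log t - (B + |Real.log t| + |B|) ≤ blockEntropy ν n := by
      intro n
      cases n with
      | zero =>
        have h1 := blockEntropy_nonneg (μ := ν) 0
        have h2 := abs_nonneg (Real.log t)
        have h3 := neg_abs_le B
        push_cast
        linarith
      | succ n =>
        have h1 := le_blockEntropy_of_wordProb_le (hword n)
        have h2 := le_abs_self (Real.log t)
        have h3 := abs_nonneg B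
        push_cast
        linarith
    exact le_limsup_div (blockEntropy_concave hνs) hlow

/-- A measure of maximal entropy is the Markov measure with the Parry transition probabilities. -/
theorem IsIASFT.wordProb_snoc (hM : IsIASFT M μ) (ht : 0 < t) (hr : ∀ a, 0 < r a)
    (hrt : (M.map (Int.cast : ℤ → ℝ)).mulVec r = t • r) {n : ℕ} (w : Fin (n + 1) → A) (b : A) :
    wordProb μ (Fin.snoc w b : Fin (n + 2) → A)
      = wordProb μ w * parryMatrix (M.map Int.cast) t r (w (Fin.last n)) b := by
  have := hM.maxEntropy.invariantProb.isProbabilityMeasure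
  have hμ := hM.maxEntropy.invariantProb.invariant
  have : Nonempty A := ⟨w 0⟩
  obtain ⟨ν, hν, hent⟩ :=
    exists_log_le_entropy hM.zero_one hM.irreducible hM.aperiodic ht hr hrt
  set p := parryMatrix (M.map Int.cast) t r with hp
  have hsnoc : ∀ (w : Fin (n + 1) → A) (b : A),
      0 < wordProb μ (Fin.snoc w b : Fin (n + 2) → A) → M (w (Fin.last n)) b = 1 := fun w b h => by
    by_contra hcon
    exact h.ne' (wordProb_snoc_eq_zero hM.maxEntropy.invariantProb.carried hcon)
  have hpM : ∀ a b, M a b = 1 → p a b = r b / (t * r a) := fun a b h => by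
    simp [hp, parryMatrix, h]
  refine wordProb_snoc_eq_of_entropy_le (K := fun w b => p (w (Fin.last n)) b) ?_ ?_ ?_ ?_ w b
  · exact fun w b => div_nonneg (mul_nonneg (by simpa using hM.irreducible.nonneg _ _) (hr b).le)
      (mul_pos ht (hr _)).le
  · intro w
    have := congrFun hrt (w (Fin.last n))
    simp only [hp, parryMatrix, Matrix.of_apply, ← Finset.sum_div]
    exact (div_le_one (mul_pos ht (hr _))).2 this.le
  · intro w b h
    rw [hpM _ _ (hsnoc w b h)]
    exact div_pos (hr b) (mul_pos ht (hr _))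
  -- On an edge, `log p` is `log r` at its end minus `log r` at its start minus `log t`. The first
  -- two terms cancel on average, leaving `-log t`.
  · have hlog : ∀ (w : Fin (n + 1) → A) (b : A),
        wordProb μ (Fin.snoc w b : Fin (n + 2) → A) * Real.log (p (w (Fin.last n)) b)
        = wordProb μ (Fin.snoc w b : Fin (n + 2) → A) * Real.log (r b)
          - wordProb μ (Fin.snoc w b : Fin (n + 2) → A) * Real.log (r (w (Fin.last n)))
          - wordProb μ (Fin.snoc w b : Fin (n + 2) → A) * Real.log t := by
      intro w b
      rcases (wordProb_nonneg (μ := μ) (Fin.snoc w b : Fin (n + 2) → A)).eq_or_lt' with h | h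
      · simp [h]
      · rw [hpM _ _ (hsnoc w b h), Real.log_div (hr b).ne' (mul_pos ht (hr _)).ne',
          Real.log_mul ht.ne' (hr _).ne']
        ring
    have hsum : ∑ w : Fin (n + 1) → A, ∑ b, wordProb μ (Fin.snoc w b : Fin (n + 2) → A)
        * Real.log (p (w (Fin.last n)) b) = -Real.log t := by
      simp_rw [hlog, Finset.sum_sub_distrib]
      rw [sum_snoc_mul_last hμ fun a => Real.log (r a)]
      simp_rw [← Finset.sum_mul, sum_wordProb_snoc]
      rw [sum_wordProb]
      ring
    rw [hsum]
    -- The chain `log t ≤ entropy ν ≤ entropy μ ≤` increment puts Gibbs' inequality in its equality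
    -- case.
    have h1 := entropy_le_increment hμ (n + 1)
    have h2 := hM.maxEntropy.maximal ν hν
    linarith

end MaxEntropy

/-! ### Support of the measure and joint occurrence of distant words -/

section Support

variable {A : Type*}

/-- `x` follows edges of `M` at all times between `i` and `j`. -/
def Allowed (M : Matrix A A ℤ) (x : ℤ → A) (i j : ℤ) : Prop :=
  ∀ l, i ≤ l → l < j → M (x l) (x (l + 1)) = 1

theorem block_succ_eq_snoc (a : ℤ) (n : ℕ) (x : ℤ → A) :
    block a (n + 1) x = (Fin.snoc (block a n x) (x (a + n)) : Fin (n + 1) → A) := by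
  have : x ∈ block a n ⁻¹' {block a n x} ∩ (fun y => y (a + n)) ⁻¹' {x (a + n)} := ⟨rfl, rfl⟩
  rwa [← block_preimage_snoc] at this

theorem allowed_succ {M : Matrix A A ℤ} {x : ℤ → A} {i : ℤ} {n : ℕ} :
    Allowed M x i (i + (n + 1 : ℕ)) ↔
      Allowed M x i (i + n) ∧ M (x (i + n)) (x (i + n + 1)) = 1 := by
  refine ⟨fun h => ⟨fun l h1 h2 => h l h1 (by push_cast; omega),
      h _ (by omega) (by push_cast; omega)⟩,
    fun h l h1 h2 => ?_⟩
  rcases (show l < i + n ∨ l = i + n by push_cast at h2; omega) with h3 | rfl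
  · exact h.1 l h1 h3
  · exact h.2

theorem exists_allowed [Fintype A] [DecidableEq A] {M : Matrix A A ℤ}
    (h01 : ∀ a b, M a b = 0 ∨ M a b = 1) (i : ℤ) (k : ℕ) (a b : A) (h : 0 < (M ^ k) a b) :
    ∃ x : ℤ → A, x i = a ∧ x (i + k) = b ∧ Allowed M x i (i + k) := by
  induction k generalizing b with
  | zero =>
    refine ⟨fun _ => a, rfl, ?_, fun l h1 h2 => by simp at h2; omega⟩
    by_contra hab
    simp [show a ≠ b from hab] at h
  | succ k ih =>
    rw [pow_succ, Matrix.mul_apply] at h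
    obtain ⟨c, -, hc⟩ := Finset.exists_lt_of_sum_lt (by simpa using h :
      ∑ _c : A, (0 : ℤ) < ∑ c, (M ^ k) a c * M c b)
    have hcb : M c b = 1 := (h01 c b).resolve_left fun h0 => by simp [h0] at hc
    rw [hcb, mul_one] at hc
    obtain ⟨x, hxi, hxk, hx⟩ := ih c hc
    refine ⟨Function.update x (i + k + 1) b, ?_, ?_, allowed_succ.2 ⟨fun l h1 h2 => ?_, ?_⟩⟩
    · rw [Function.update_of_ne (by omega), hxi]
    · rw [Nat.cast_succ, ← add_assoc, Function.update_self]
    · rw [Function.update_of_ne (by omega), Function.update_of_ne (by omega)]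
      exact hx l h1 h2
    · rw [Function.update_self, Function.update_of_ne (by omega), hxk, hcb]

theorem Allowed.glue {M : Matrix A A ℤ} {x y : ℤ → A} {i j k : ℤ} (hx : Allowed M x i j)
    (hy : Allowed M y j k) (h : x j = y j) :
    Allowed M (fun l => if l ≤ j then x l else y l) i k := by
  intro l h1 h2
  rcases lt_or_ge l j with h3 | h3
  · simp only [h3.le, show l + 1 ≤ j by omega, if_true]
    exact hx l h1 h3
  · have h4 : (if l ≤ j then x l else y l) = y l := by
      split_ifs with h5
      · rw [le_antisymm h5 h3, h]
      · rfl
    simp only [h4, show ¬ l + 1 ≤ j by omega, if_false]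
    exact hy l h3 h2

variable [Fintype A] [DecidableEq A] [MeasurableSpace A] [MeasurableSingletonClass A]
  [TopologicalSpace A] [DiscreteTopology A] {M : Matrix A A ℤ} {μ : Measure (ℤ → A)}

omit [MeasurableSingletonClass A] [TopologicalSpace A] [DiscreteTopology A] in
theorem IsIASFT.nonempty (hM : IsIASFT M μ) : Nonempty A := by
  have := hM.maxEntropy.invariantProb.isProbabilityMeasure
  obtain ⟨x⟩ := nonempty_of_isProbabilityMeasure μ
  exact ⟨x 0⟩

omit [MeasurableSingletonClass A] [TopologicalSpace A] [DiscreteTopology A] in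
theorem IsIASFT.exists_perron (hM : IsIASFT M μ) : ∃ (t : ℝ) (r : A → ℝ), 0 < t ∧ (∀ a, 0 < r a) ∧
    (M.map (Int.cast : ℤ → ℝ)).mulVec r = t • r := by
  have := hM.nonempty
  obtain ⟨N, hN⟩ := (eventually_pow_pos hM.irreducible hM.aperiodic).exists_forall_of_atTop
  exact PIJ.exists_perron (N := N + 1) (fun a b => by simpa using hM.irreducible.nonneg a b)
    (by simp) (fun a b => by rw [intCast_map_pow]; simpa using hN (N + 1) (by simp) a b)

/-- Each further letter multiplies the probability by a Parry factor, positive exactly on edges. The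
transitions alone do not show that the first letter has positive probability, hence the separate
condition. -/
theorem IsIASFT.wordProb_block_pos_iff (hM : IsIASFT M μ) (a : ℤ) (n : ℕ) (x : ℤ → A) :
    0 < wordProb μ (block a (n + 1) x) ↔
      0 < wordProb μ (block a 1 x) ∧ Allowed M x a (a + n) := by
  obtain ⟨t, r, ht, hr, hrt⟩ := hM.exists_perron
  induction n with
  | zero =>
    simp only [Nat.cast_zero, add_zero, iff_self_and]
    exact fun _ l h1 h2 => absurd h1 (by omega)
  | succ n ih =>
    have hp : 0 < parryMatrix (M.map Int.cast) t r (x (a + n)) (x (a + n + 1))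
        ↔ M (x (a + n)) (x (a + n + 1)) = 1 := by
      rcases hM.zero_one (x (a + n)) (x (a + n + 1)) with h | h
      · simp [parryMatrix, h]
      · simp [parryMatrix, h, hr, ht]
    have hlast : block a (n + 1) x (Fin.last n) = x (a + n) := by simp [block]
    rw [block_succ_eq_snoc, hM.wordProb_snoc ht hr hrt, allowed_succ, ← and_assoc, ← ih, hlast,
      Nat.cast_succ, ← add_assoc, ← hp]
    refine ⟨fun h => ?_, fun h => mul_pos h.1 h.2⟩
    have h1 := (wordProb_nonneg (μ := μ) (block a (n + 1) x)).lt_of_ne'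
      (left_ne_zero_of_mul h.ne')
    exact ⟨h1, pos_of_mul_pos_right h h1.le⟩

/-- Some letter has positive probability and a path leads from it to any other; stationarity brings
the end of the path back to time 0. -/
theorem IsIASFT.wordProb_letter_pos (hM : IsIASFT M μ) (w : Fin 1 → A) : 0 < wordProb μ w := by
  have := hM.maxEntropy.invariantProb.isProbabilityMeasure
  have hμ := hM.maxEntropy.invariantProb.invariant
  obtain ⟨v, -, hv⟩ := Finset.exists_lt_of_sum_lt (by simp [sum_wordProb] :
      ∑ _v : Fin 1 → A, (0 : ℝ) < ∑ v, wordProb μ v)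
  obtain ⟨k, hk⟩ := (eventually_pow_pos hM.irreducible hM.aperiodic).exists
  obtain ⟨x, hx0, hxk, hx⟩ := exists_allowed hM.zero_one 0 k _ _ (hk (v 0) (w 0))
  have hv' : block 0 1 x = v := by
    ext i
    rw [Subsingleton.elim i 0]
    simpa [block] using hx0
  have hpos := (hM.wordProb_block_pos_iff 0 k x).2 ⟨hv' ▸ hv, hx⟩
  rw [← real_block_eq_wordProb hμ k]
  refine hpos.trans_le (measureReal_mono fun y hy => ?_)
  ext i
  rw [Subsingleton.elim i 0]
  have := congrFun hy (Fin.last k)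
  simp only [block, Fin.val_last, Fin.val_zero, Nat.cast_zero, add_zero, zero_add] at this ⊢ hxk
  rw [this, hxk]

theorem IsIASFT.real_block_pos_iff (hM : IsIASFT M μ) (a : ℤ) (n : ℕ) (x : ℤ → A) :
    0 < μ.real (block a (n + 1) ⁻¹' {block a (n + 1) x}) ↔ Allowed M x a (a + n) := by
  rw [real_block_eq_wordProb hM.maxEntropy.invariantProb.invariant, hM.wordProb_block_pos_iff,
    and_iff_right (hM.wordProb_letter_pos _)]

/-- Two words of positive probability occur together with positive probability as soon as they
are far enough from one another. -/
theorem IsIASFT.exists_gap (hM : IsIASFT M μ) : ∃ K : ℕ, ∀ (a b : ℤ) (n m : ℕ), a + n + K ≤ b →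
    ∀ (c : Fin (n + 1) → A) (d : Fin (m + 1) → A), 0 < μ.real (block a (n + 1) ⁻¹' {c}) →
      0 < μ.real (block b (m + 1) ⁻¹' {d}) →
      0 < μ.real (block a (n + 1) ⁻¹' {c} ∩ block b (m + 1) ⁻¹' {d}) := by
  have := hM.nonempty
  have := hM.maxEntropy.invariantProb.isProbabilityMeasure
  obtain ⟨K, hK⟩ := (eventually_pow_pos hM.irreducible hM.aperiodic).exists_forall_of_atTop
  refine ⟨K, fun a b n m hab c d hc hd => ?_⟩
  obtain ⟨x, rfl⟩ := block_surjective a (n + 1) c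
  obtain ⟨y, rfl⟩ := block_surjective b (m + 1) d
  rw [hM.real_block_pos_iff] at hc hd
  obtain ⟨k, hk⟩ := Int.eq_ofNat_of_zero_le (show 0 ≤ b - (a + n) by omega)
  obtain ⟨p, hp1, hp2, hp⟩ := exists_allowed hM.zero_one (a + n) k _ _
    (hK k (by omega) (x (a + n)) (y b))
  rw [show a + n + k = b by omega] at hp2 hp
  -- The first word, a connecting path and the second word form one allowed word, whose cylinder
  -- lies in both events. If `K = 0` the two words may meet at `b = a + n`, where the path of length
  -- 0 identifies their letters.
  have hz := (hc.glue hp hp1.symm).glue hd (by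
    rcases (show b ≤ a + n ∨ ¬ b ≤ a + n by omega) with h | h
    · rw [if_pos h, ← hp2, show b = a + n by omega, hp1]
    · rw [if_neg h, hp2])
  set z : ℤ → A := fun l => if l ≤ b then (if l ≤ a + n then x l else p l) else y l with hzdef
  obtain ⟨N, hN⟩ := Int.eq_ofNat_of_zero_le (show 0 ≤ b + m - a by omega)
  rw [show b + m = a + N by omega] at hz
  refine ((hM.real_block_pos_iff a N z).2 hz).trans_le (measureReal_mono fun u hu => ?_)
  have hu' : ∀ l : ℤ, a ≤ l → l ≤ b + m → u l = z l := by
    intro l h1 h2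
    have := congrFun hu ⟨(l - a).toNat, by omega⟩
    simp only [block] at this
    rwa [show a + ((l - a).toNat : ℤ) = l by omega] at this
  refine ⟨funext fun i => ?_, funext fun i => ?_⟩
  · have := i.2
    rw [block, block, hu' _ (by omega) (by omega), hzdef]
    simp only
    rw [if_pos (by omega), if_pos (by omega)]
  · have := i.2
    rw [block, block, hu' _ (by omega) (by omega), hzdef]
    simp only
    by_cases h0 : (i : ℕ) = 0
    · rw [h0, Nat.cast_zero, add_zero, if_pos le_rfl]
      split_ifs with h
      · rw [← hp2, show b = a + n by omega, hp1]
      · exact hp2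
    · rw [if_neg (by omega)]

end Support

/-! ### Independence extracted from pairwise independence -/

section Independence

variable {Ω : Type*} [MeasurableSpace Ω] {P : Measure Ω} [IsProbabilityMeasure P]

omit [IsProbabilityMeasure P] in
theorem _root_.ProbabilityTheory.IndepFun.real_inter {B C : Type*} [MeasurableSpace B]
    [MeasurableSpace C] {X : Ω → B} {Y : Ω → C} (h : IndepFun X Y P) {s : Set B} {t : Set C}
    (hs : MeasurableSet s) (ht : MeasurableSet t) :
    P.real (X ⁻¹' s ∩ Y ⁻¹' t) = P.real (X ⁻¹' s) * P.real (Y ⁻¹' t) := by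
  simp only [measureReal_def, h.measure_inter_preimage_eq_mul s t hs ht, ENNReal.toReal_mul]

theorem real_preimage_eq_sum {B : Type*} [Fintype B] [MeasurableSpace B]
    [MeasurableSingletonClass B] {X : Ω → B} (hX : Measurable X) (s : Set B)
    [DecidablePred (· ∈ s)] :
    P.real (X ⁻¹' s) = ∑ b, P.real (X ⁻¹' {b}) * if b ∈ s then 1 else 0 := by
  rw [← sum_real_inter_fiber P (X ⁻¹' s) hX]
  refine Finset.sum_congr rfl fun b _ => ?_
  split_ifs with h
  · rw [mul_one, Set.inter_eq_right.2]
    rintro ω rfl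
    exact h
  · rw [mul_zero, show X ⁻¹' s ∩ X ⁻¹' {b} = ∅ by
      refine Set.eq_empty_of_forall_notMem ?_
      rintro ω ⟨h1, rfl⟩
      exact h h1, measureReal_empty]

theorem indepFun_of_singletons {B C : Type*} [Fintype B] [MeasurableSpace B]
    [MeasurableSingletonClass B] [Fintype C] [MeasurableSpace C] [MeasurableSingletonClass C]
    {X : Ω → B} {Y : Ω → C} (hX : Measurable X) (hY : Measurable Y)
    (h : ∀ b c, P.real (X ⁻¹' {b} ∩ Y ⁻¹' {c}) = P.real (X ⁻¹' {b}) * P.real (Y ⁻¹' {c})) :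
    IndepFun X Y P := by
  rw [indepFun_iff_map_prod_eq_prod_map_map hX.aemeasurable hY.aemeasurable]
  refine Measure.ext_of_singleton fun ⟨b, c⟩ => ?_
  rw [← Set.singleton_prod_singleton, Measure.prod_prod,
    Measure.map_apply (hX.prodMk hY) ((measurableSet_singleton b).prod (measurableSet_singleton c)),
    Measure.map_apply hX (measurableSet_singleton b),
    Measure.map_apply hY (measurableSet_singleton c)]
  have := h b c
  simp only [measureReal_def, ← ENNReal.toReal_mul] at this
  exact (ENNReal.toReal_eq_toReal_iff' (measure_ne_top _ _)
    (ENNReal.mul_ne_top (measure_ne_top _ _) (measure_ne_top _ _))).1 this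

variable {B₁ B₂ C₁ C₂ D₁ D₂ : Type*}
  [Fintype B₁] [MeasurableSpace B₁] [MeasurableSingletonClass B₁]
  [Fintype B₂] [MeasurableSpace B₂] [MeasurableSingletonClass B₂]
  [Fintype C₁] [MeasurableSpace C₁] [MeasurableSingletonClass C₁]
  [Fintype C₂] [MeasurableSpace C₂] [MeasurableSingletonClass C₂]
  [Fintype D₁] [MeasurableSpace D₁] [MeasurableSingletonClass D₁]
  [Fintype D₂] [MeasurableSpace D₂] [MeasurableSingletonClass D₂]
  {X₁ : Ω → B₁} {X₂ : Ω → B₂} {Y₁ : Ω → C₁} {Y₂ : Ω → C₂} {Z₁ : Ω → D₁} {Z₂ : Ω → D₂}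

omit [IsProbabilityMeasure P] [Fintype B₁] [Fintype D₁] in
/-- If `Z = F (X, Y)` with `X`, `Y` independent and `Z`, `X` independent, then `F (b, Y)` has the
law of `Z` for every value `b` that `X` takes. -/
theorem real_comp_eq_of_indepFun {F : B₁ → C₁ → D₁} (hXY : IndepFun X₁ Y₁ P)
    (hZX : IndepFun Z₁ X₁ P) (hZ : ∀ᵐ ω ∂P, Z₁ ω = F (X₁ ω) (Y₁ ω)) (s : D₁) {b : B₁}
    (hb : P.real (X₁ ⁻¹' {b}) ≠ 0) : P.real (Y₁ ⁻¹' {c | F b c = s}) = P.real (Z₁ ⁻¹' {s}) := by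
  have h1 := hXY.real_inter (measurableSet_singleton b) (Set.toFinite {c | F b c = s}).measurableSet
  have h2 := hZX.real_inter (measurableSet_singleton s) (measurableSet_singleton b)
  have h3 : P.real (Z₁ ⁻¹' {s} ∩ X₁ ⁻¹' {b}) = P.real (X₁ ⁻¹' {b} ∩ Y₁ ⁻¹' {c | F b c = s}) := by
    refine measureReal_congr ?_
    filter_upwards [hZ] with ω hω
    refine propext ⟨?_, ?_⟩
    · rintro ⟨hs, rfl⟩
      exact ⟨rfl, hω.symm.trans hs⟩
    · rintro ⟨rfl, hs⟩
      exact ⟨hω.trans hs, rfl⟩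
  rw [h1, h2, mul_comm] at h3
  exact (mul_left_cancel₀ hb h3).symm

theorem indepFun_of_pairwise (hX₁ : Measurable X₁) (hX₂ : Measurable X₂) (hY₁ : Measurable Y₁)
    (hY₂ : Measurable Y₂) (hZ₁ : Measurable Z₁) (hZ₂ : Measurable Z₂)
    (hXY : IndepFun (fun ω => (X₁ ω, X₂ ω)) (fun ω => (Y₁ ω, Y₂ ω)) P)
    (hZY : IndepFun (fun ω => (Z₁ ω, Z₂ ω)) (fun ω => (Y₁ ω, Y₂ ω)) P)
    (hZX : IndepFun (fun ω => (Z₁ ω, Z₂ ω)) (fun ω => (X₁ ω, X₂ ω)) P)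
    {F₁ : B₁ → C₁ → D₁} {F₂ : B₂ → C₂ → D₂} (hF₁ : ∀ᵐ ω ∂P, Z₁ ω = F₁ (X₁ ω) (Y₁ ω))
    (hF₂ : ∀ᵐ ω ∂P, Z₂ ω = F₂ (X₂ ω) (Y₂ ω))
    (hsupp : ∀ c d, 0 < P.real (Y₁ ⁻¹' {c}) → 0 < P.real (Y₂ ⁻¹' {d}) →
      0 < P.real (Y₁ ⁻¹' {c} ∩ Y₂ ⁻¹' {d})) : IndepFun Z₁ Z₂ P := by
  classical
  refine indepFun_of_singletons hZ₁ hZ₂ fun s t => ?_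
  set X : Ω → B₁ × B₂ := fun ω => (X₁ ω, X₂ ω)
  have hX : Measurable X := hX₁.prodMk hX₂
  -- Both laws agree given `Y = (c, d)`. The weights are products of marginals, not the joint law of
  -- `Y`; `hsupp` ensures that every pair of nonzero weight can be conditioned on.
  have key : ∀ c d, P.real (Y₁ ⁻¹' {c}) * P.real (Y₂ ⁻¹' {d}) * P.real (Z₁ ⁻¹' {s} ∩ Z₂ ⁻¹' {t})
      = P.real (Y₁ ⁻¹' {c}) * P.real (Y₂ ⁻¹' {d})
        * P.real (X ⁻¹' {q | F₁ q.1 c = s ∧ F₂ q.2 d = t}) := by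
    intro c d
    rcases (measureReal_nonneg (μ := P) (s := Y₁ ⁻¹' {c})).eq_or_lt' with hc | hc
    · simp [hc]
    rcases (measureReal_nonneg (μ := P) (s := Y₂ ⁻¹' {d})).eq_or_lt' with hd | hd
    · simp [hd]
    congr 1
    have h1 := hZY.real_inter (s := {s} ×ˢ {t}) (t := {c} ×ˢ {d})
      (Set.toFinite _).measurableSet (Set.toFinite _).measurableSet
    have h2 := hXY.real_inter (s := {q | F₁ q.1 c = s ∧ F₂ q.2 d = t}) (t := {c} ×ˢ {d})
      (Set.toFinite _).measurableSet (Set.toFinite _).measurableSet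
    have h3 : P.real ((fun ω => (Z₁ ω, Z₂ ω)) ⁻¹' ({s} ×ˢ {t}) ∩
          (fun ω => (Y₁ ω, Y₂ ω)) ⁻¹' ({c} ×ˢ {d}))
        = P.real (X ⁻¹' {q | F₁ q.1 c = s ∧ F₂ q.2 d = t} ∩
          (fun ω => (Y₁ ω, Y₂ ω)) ⁻¹' ({c} ×ˢ {d})) := by
      refine measureReal_congr ?_
      filter_upwards [hF₁, hF₂] with ω hω₁ hω₂
      refine propext (and_congr_left ?_)
      rintro ⟨rfl, rfl⟩
      exact and_congr (Eq.congr_left hω₁) (Eq.congr_left hω₂)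
    rw [h1, h2] at h3
    exact mul_right_cancel₀ (hsupp c d hc hd).ne' h3
  have hsum₁ : ∑ c, P.real (Y₁ ⁻¹' {c}) = 1 := by
    simpa using sum_real_inter_fiber P Set.univ hY₁
  have hsum₂ : ∑ d, P.real (Y₂ ⁻¹' {d}) = 1 := by
    simpa using sum_real_inter_fiber P Set.univ hY₂
  have hsumX : ∑ q, P.real (X ⁻¹' {q}) = 1 := by
    simpa using sum_real_inter_fiber P Set.univ hX
  have hXY₁ : IndepFun X₁ Y₁ P := hXY.comp measurable_fst measurable_fst
  have hXY₂ : IndepFun X₂ Y₂ P := hXY.comp measurable_snd measurable_snd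
  have hZX₁ : IndepFun Z₁ X₁ P := hZX.comp measurable_fst measurable_fst
  have hZX₂ : IndepFun Z₂ X₂ P := hZX.comp measurable_snd measurable_snd
  -- For fixed `X = q`, independence of `X` from `Y` and from `Z` turns each factor into a
  -- probability for `Z₁` or `Z₂`, free of `q`.
  have hfiber : ∀ q, P.real (X ⁻¹' {q}) *
      (P.real (Y₁ ⁻¹' {c | F₁ q.1 c = s}) * P.real (Y₂ ⁻¹' {d | F₂ q.2 d = t}))
      = P.real (X ⁻¹' {q}) * (P.real (Z₁ ⁻¹' {s}) * P.real (Z₂ ⁻¹' {t})) := by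
    intro q
    rcases (measureReal_nonneg (μ := P) (s := X ⁻¹' {q})).eq_or_lt' with hq | hq
    · simp [hq]
    have hq₁ : 0 < P.real (X₁ ⁻¹' {q.1}) :=
      hq.trans_le (measureReal_mono fun ω (hω : X ω = q) => congrArg Prod.fst hω)
    have hq₂ : 0 < P.real (X₂ ⁻¹' {q.2}) :=
      hq.trans_le (measureReal_mono fun ω (hω : X ω = q) => congrArg Prod.snd hω)
    rw [real_comp_eq_of_indepFun hXY₁ hZX₁ hF₁ s hq₁.ne',
      real_comp_eq_of_indepFun hXY₂ hZX₂ hF₂ t hq₂.ne']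
  calc P.real (Z₁ ⁻¹' {s} ∩ Z₂ ⁻¹' {t})
      = ∑ c, ∑ d, P.real (Y₁ ⁻¹' {c}) * P.real (Y₂ ⁻¹' {d})
          * P.real (Z₁ ⁻¹' {s} ∩ Z₂ ⁻¹' {t}) := by
        simp_rw [← Finset.sum_mul, ← Finset.mul_sum, hsum₂, mul_one, hsum₁, one_mul]
    _ = ∑ c, ∑ d, ∑ q, P.real (X ⁻¹' {q}) * ((P.real (Y₁ ⁻¹' {c}) * if F₁ q.1 c = s then 1 else 0)
          * (P.real (Y₂ ⁻¹' {d}) * if F₂ q.2 d = t then 1 else 0)) := by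
        refine Finset.sum_congr rfl fun c _ => Finset.sum_congr rfl fun d _ => ?_
        rw [key, real_preimage_eq_sum hX, Finset.mul_sum]
        refine Finset.sum_congr rfl fun q _ => ?_
        simp only [Set.mem_ofPred_eq, ite_and]
        split_ifs <;> ring
    _ = ∑ q, P.real (X ⁻¹' {q}) *
          (P.real (Y₁ ⁻¹' {c | F₁ q.1 c = s}) * P.real (Y₂ ⁻¹' {d | F₂ q.2 d = t})) := by
        simp_rw [Finset.sum_comm (s := (Finset.univ : Finset C₂))]
        rw [Finset.sum_comm]
        refine Finset.sum_congr rfl fun q _ => ?_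
        rw [real_preimage_eq_sum hY₁, real_preimage_eq_sum hY₂, Finset.sum_mul_sum]
        simp_rw [Finset.mul_sum]
        rfl
    _ = P.real (Z₁ ⁻¹' {s}) * P.real (Z₂ ⁻¹' {t}) := by
        simp_rw [hfiber, ← Finset.sum_mul, hsumX, one_mul]

end Independence

/-! ### Finite windows for the continuous function -/

section Window

variable {A : Type*} [Fintype A] [TopologicalSpace A] [DiscreteTopology A]

/-- A continuous function of two sequences with values in a finite alphabet depends only on
finitely many coordinates. -/
theorem exists_window {φ : (ℤ → A) × (ℤ → A) → A} (hφ : Continuous φ) :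
    ∃ m : ℕ, ∀ x x' y y' : ℤ → A, block (-m) (2 * m + 1) x = block (-m) (2 * m + 1) x' →
      block (-m) (2 * m + 1) y = block (-m) (2 * m + 1) y' → φ (x, y) = φ (x', y') := by
  by_contra! hcon
  choose x x' y y' hx hy hne using hcon
  have hle : (hyperfilter ℕ : Filter ℕ) ≤ atTop := Nat.hyperfilter_le_atTop
  -- Pairs agreeing on growing windows have the same limit `q` along an ultrafilter. As `A` is
  -- discrete, `φ` eventually equals `φ q` on both, contradicting `hne`.
  obtain ⟨q, -, hq⟩ := isCompact_univ.ultrafilter_le_nhds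
    ((hyperfilter ℕ).map fun m => (x m, y m)) (by simp)
  have hq : Tendsto (fun m => (x m, y m)) (hyperfilter ℕ : Filter ℕ) (nhds q) := hq
  have hagree : ∀ (u u' : ℕ → ℤ → A), (∀ m : ℕ, block (-m) (2 * m + 1) (u m)
      = block (-m) (2 * m + 1) (u' m)) → ∀ {v : ℤ → A},
      Tendsto u (hyperfilter ℕ : Filter ℕ) (nhds v) →
      Tendsto u' (hyperfilter ℕ : Filter ℕ) (nhds v) := by
    intro u u' huu v hu
    rw [tendsto_pi_nhds] at hu ⊢
    intro i
    refine (hu i).congr' ?_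
    filter_upwards [hle (eventually_ge_atTop i.natAbs)] with m hm
    have := congrFun (huu m) ⟨(i + m).toNat, by omega⟩
    simp only [block] at this
    rwa [show -(m : ℤ) + ((i + m).toNat : ℤ) = i by omega] at this
  have hq' : Tendsto (fun m => (x' m, y' m)) (hyperfilter ℕ : Filter ℕ) (nhds q) :=
    (hagree x x' hx ((continuous_fst.tendsto q).comp hq)).prodMk_nhds
      (hagree y y' hy ((continuous_snd.tendsto q).comp hq))
  have h1 := (hφ.tendsto q).comp hq
  have h2 := (hφ.tendsto q).comp hq'
  rw [nhds_discrete, tendsto_pure] at h1 h2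
  obtain ⟨m, hm1, hm2⟩ := (h1.and h2).exists
  exact hne m (hm1.trans hm2.symm)

variable [MeasurableSpace A] [MeasurableSingletonClass A] {μ : Measure (ℤ → A)}

/-- In a pairwise-independent joining, blocks of the third process are functions of slightly
longer blocks of the two others. -/
theorem HasPIJ.exists_block_eq [Nonempty A] (h : HasPIJ μ) :
    ∃ (lam : Measure (Fin 3 → ℤ → A)) (m : ℕ), IsPairwiseIndepJoining μ lam ∧
      ∀ (a : ℤ) (n : ℕ), ∃ F : (Fin (n + 2 * m) → A) → (Fin (n + 2 * m) → A) → Fin n → A,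
        ∀ᵐ z ∂lam, block a n (z 2)
          = F (block (a - m) (n + 2 * m) (z 0)) (block (a - m) (n + 2 * m) (z 1)) := by
  obtain ⟨lam, φ, hlam, hφ, hz⟩ := h
  obtain ⟨m, hm⟩ := exists_window hφ
  choose e he using block_surjective (A := A) (-m) (2 * m + 1)
  let f : (Fin (2 * m + 1) → A) → (Fin (2 * m + 1) → A) → A := fun u v => φ (e u, e v)
  have hf : ∀ x y, φ (x, y) = f (block (-m) (2 * m + 1) x) (block (-m) (2 * m + 1) y) :=
    fun x y => hm _ _ _ _ (he _).symm (he _).symm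
  let N : ℤ → Set (Fin 3 → ℤ → A) := fun i => {z | z 2 i
    = f (block (i - m) (2 * m + 1) (z 0)) (block (i - m) (2 * m + 1) (z 1))}ᶜ
  have hNmeas : ∀ i, MeasurableSet (N i) := fun i => by
    refine (measurableSet_eq_fun (by fun_prop) ?_).compl
    exact (measurable_of_finite (fun q : (Fin (2 * m + 1) → A) × (Fin (2 * m + 1) → A) =>
      f q.1 q.2)).comp (f := fun z : Fin 3 → ℤ → A =>
        (block (i - m) (2 * m + 1) (z 0), block (i - m) (2 * m + 1) (z 1)))
      (((measurable_block _ _).comp (measurable_pi_apply 0)).prodMk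
        ((measurable_block _ _).comp (measurable_pi_apply 1)))
  -- Joint stationarity carries the identity from time 0 to every time; `N i` is the exceptional set
  -- at time `i`.
  have hNstep : ∀ i, lam (N (i + 1)) = lam (N i) := fun i => by
    rw [← hlam.selfJoining.stationary.measure_preimage (hNmeas i).nullMeasurableSet]
    congr 1
    ext z
    simp only [N, Set.mem_compl_iff, Set.mem_preimage, Set.mem_ofPred_eq, block_shift]
    rw [show i + 1 - (m : ℤ) = i - m + 1 by ring, add_comm i 1]
    rfl
  have hN0 : lam (N 0) = 0 := by
    refine measure_mono_null (fun z hz' => ?_) hz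
    simp only [N, Set.mem_compl_iff, Set.mem_ofPred_eq, zero_sub] at hz' ⊢
    rwa [hf]
  have hN : ∀ i, lam (N i) = 0 := fun i => by
    induction i using Int.induction_on with
    | zero => exact hN0
    | succ i ih => rw [hNstep, ih]
    | pred i ih => rw [← hNstep, sub_add_cancel, ih]
  refine ⟨lam, m, hlam, fun a n => ⟨fun u v i => f (fun j => u ⟨i + j, by omega⟩)
    (fun j => v ⟨i + j, by omega⟩), ?_⟩⟩
  have hall : ∀ᵐ z ∂lam, ∀ i : ℤ, z 2 i
      = f (block (i - m) (2 * m + 1) (z 0)) (block (i - m) (2 * m + 1) (z 1)) :=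
    ae_all_iff.2 fun i => hN i
  filter_upwards [hall] with z hz
  funext i
  rw [block, hz]
  congr 1 <;>
  · funext j
    simp only [block]
    congr 1
    push_cast
    ring

end Window

/-! ### Independence of distant blocks -/

section Main

variable {A : Type*} [Fintype A] [DecidableEq A] [TopologicalSpace A] [DiscreteTopology A]
  [MeasurableSpace A] [MeasurableSingletonClass A] {M : Matrix A A ℤ} {μ : Measure (ℤ → A)}

omit [Fintype A] [DecidableEq A] [TopologicalSpace A] [DiscreteTopology A]
  [MeasurableSingletonClass A] in
theorem IsPairwiseIndepJoining.indepFun [IsProbabilityMeasure μ] {lam : Measure (Fin 3 → ℤ → A)}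
    (h : IsPairwiseIndepJoining μ lam) [IsProbabilityMeasure lam] {i j : Fin 3} (hij : i ≠ j) :
    IndepFun (fun z : Fin 3 → ℤ → A => z i) (fun z => z j) lam := by
  rw [indepFun_iff_map_prod_eq_prod_map_map (measurable_pi_apply i).aemeasurable
    (measurable_pi_apply j).aemeasurable, h.pairwise i j hij, h.selfJoining.marginal,
    h.selfJoining.marginal]

/-- Distant blocks of an irreducible aperiodic subshift of finite type with the PIJ property are
independent. -/
theorem IsIASFT.exists_indepFun_block (hM : IsIASFT M μ) (hPIJ : HasPIJ μ) : ∃ K : ℕ,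
    ∀ (a b : ℤ) (n m : ℕ), a + n + K ≤ b → IndepFun (block a (n + 1)) (block b (m + 1)) μ := by
  have := hM.nonempty
  have := hM.maxEntropy.invariantProb.isProbabilityMeasure
  obtain ⟨lam, l, hlam, hF⟩ := hPIJ.exists_block_eq
  obtain ⟨K, hK⟩ := hM.exists_gap
  have hmarg : ∀ j, MeasurePreserving (fun z : Fin 3 → ℤ → A => z j) lam μ := fun j =>
    ⟨measurable_pi_apply j, hlam.selfJoining.marginal j⟩
  have : IsProbabilityMeasure lam := ⟨by
    simpa using (hmarg 0).measure_preimage nullMeasurableSet_univ⟩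
  -- The blocks of `z 0` and `z 1` extend `l` further on each side, which takes `2 * l` from the
  -- gap.
  refine ⟨K + 2 * l, fun a b n m hab => ?_⟩
  obtain ⟨F₁, hF₁⟩ := hF a (n + 1)
  obtain ⟨F₂, hF₂⟩ := hF b (m + 1)
  have hmeas : ∀ (j : Fin 3) (c : ℤ) (k : ℕ),
      Measurable fun z : Fin 3 → ℤ → A => block c k (z j) := fun j c k =>
    (measurable_block c k).comp (measurable_pi_apply j)
  have hpair : ∀ (c d : ℤ) (k k' : ℕ), Measurable fun x : ℤ → A => (block c k x, block d k' x) :=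
    fun c d k k' => (measurable_block c k).prodMk (measurable_block d k')
  have hind := indepFun_of_pairwise (hmeas 0 _ _) (hmeas 0 _ _) (hmeas 1 _ _) (hmeas 1 _ _)
    (hmeas 2 a (n + 1)) (hmeas 2 b (m + 1))
    ((hlam.indepFun (i := 0) (j := 1) (by decide)).comp (hpair _ _ _ _) (hpair _ _ _ _))
    ((hlam.indepFun (i := 2) (j := 1) (by decide)).comp (hpair _ _ _ _) (hpair _ _ _ _))
    ((hlam.indepFun (i := 2) (j := 0) (by decide)).comp (hpair _ _ _ _) (hpair _ _ _ _))
    hF₁ hF₂ ?_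
  · refine indepFun_of_singletons (measurable_block _ _) (measurable_block _ _) fun c d => ?_
    rw [← (hmarg 2).measureReal_preimage (measurableSet_block_preimage _ _ _).nullMeasurableSet,
      ← (hmarg 2).measureReal_preimage (measurableSet_block_preimage _ _ _).nullMeasurableSet,
      ← (hmarg 2).measureReal_preimage ((measurableSet_block_preimage _ _ _).inter
        (measurableSet_block_preimage _ _ _)).nullMeasurableSet]
    exact hind.real_inter (measurableSet_singleton c) (measurableSet_singleton d)
  · have h := hK (a - l) (b - l) (n + 2 * l) (m + 2 * l) (by push_cast at hab ⊢; omega)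
    rw [show n + 2 * l + 1 = n + 1 + 2 * l by ring, show m + 2 * l + 1 = m + 1 + 2 * l by ring] at h
    intro c d hc hd
    have h1 := h c d
    rw [← (hmarg 1).measureReal_preimage (measurableSet_block_preimage _ _ _).nullMeasurableSet,
      ← (hmarg 1).measureReal_preimage (measurableSet_block_preimage _ _ _).nullMeasurableSet,
      ← (hmarg 1).measureReal_preimage ((measurableSet_block_preimage _ _ _).inter
        (measurableSet_block_preimage _ _ _)).nullMeasurableSet] at h1
    exact h1 hc hd

end Main

/-! ### From blocks to the past and the future -/

section Main

variable {A : Type*} [Fintype A] [DecidableEq A] [TopologicalSpace A] [DiscreteTopology A]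
  [MeasurableSpace A] [MeasurableSingletonClass A] {M : Matrix A A ℤ} {μ : Measure (ℤ → A)}

omit [TopologicalSpace A] [DiscreteTopology A] [DecidableEq A] in
/-- The past up to time `0` and the future from time `k` on are independent as soon as all blocks in
them are. -/
theorem indepFun_past_future {Ω : Type*} [MeasurableSpace Ω] {P : Measure Ω}
    [IsProbabilityMeasure P] {ξ : ℤ → Ω → A} (hξ : ∀ i, Measurable (ξ i)) {k : ℤ}
    (h : ∀ (a : ℤ) (n m : ℕ), a + n = 0 → IndepFun (block a (n + 1)) (block k (m + 1)) (law P ξ)) :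
    IndepFun (fun ω (i : Set.Iic (0 : ℤ)) => ξ i ω) (fun ω (i : Set.Ici k) => ξ i ω) P := by
  have hmeas : Measurable fun ω i => ξ i ω := measurable_pi_lambda _ hξ
  refine IndepFun.process_indepFun_process (fun i => hξ i) (fun i => hξ i) fun I J => ?_
  -- Inserting 0 gives `a ≤ 0`, so that the block from `a` to 0 makes sense and covers `I`.
  obtain ⟨a, ha⟩ := (insert 0 (I.image Subtype.val)).bddBelow
  obtain ⟨c, hc⟩ := (J.image Subtype.val).bddAbove
  have ha0 : a ≤ 0 := ha (by simp)
  have haI : ∀ i : I, a ≤ ((i : Set.Iic (0 : ℤ)) : ℤ) := fun i =>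
    ha (Finset.mem_coe.2 (Finset.mem_insert_of_mem (Finset.mem_image_of_mem _ i.2)))
  have hcJ : ∀ j : J, ((j : Set.Ici k) : ℤ) ≤ c := fun j =>
    hc (Finset.mem_coe.2 (Finset.mem_image_of_mem _ j.2))
  have hI0 : ∀ i : I, ((i : Set.Iic (0 : ℤ)) : ℤ) ≤ 0 := fun i => i.1.2
  have hJk : ∀ j : J, k ≤ ((j : Set.Ici k) : ℤ) := fun j => j.1.2
  have hind : IndepFun (fun ω => block a ((-a).toNat + 1) fun i => ξ i ω)
      (fun ω => block k ((c - k).toNat + 1) fun i => ξ i ω) P := by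
    refine indepFun_of_singletons ((measurable_block _ _).comp hmeas)
      ((measurable_block _ _).comp hmeas) fun u v => ?_
    have := (h a (-a).toNat (c - k).toNat (by omega)).real_inter (measurableSet_singleton u)
      (measurableSet_singleton v)
    rwa [law, map_measureReal_apply hmeas (measurableSet_block_preimage _ _ _),
      map_measureReal_apply hmeas (measurableSet_block_preimage _ _ _),
      map_measureReal_apply hmeas
        ((measurableSet_block_preimage _ _ _).inter (measurableSet_block_preimage _ _ _))] at this
  convert hind.comp
    (φ := fun w (i : I) => w ⟨((i : Set.Iic (0 : ℤ)) - a : ℤ).toNat, by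
      have := haI i; have := hI0 i; omega⟩)
    (ψ := fun w (j : J) => w ⟨((j : Set.Ici k) - k : ℤ).toNat, by
      have := hcJ j; have := hJk j; omega⟩)
    (measurable_of_finite _) (measurable_of_finite _) using 1
  · funext ω i
    have := haI i
    simp only [Function.comp_apply, block]
    congr 1
    omega
  · funext ω j
    have := hJk j
    simp only [Function.comp_apply, block]
    congr 1
    omega

/-! ### Powers of a uniform adjacency matrix -/

section Uniform

variable {n : ℕ}

omit [DecidableEq A] [TopologicalSpace A] [DiscreteTopology A] [MeasurableSpace A]
  [MeasurableSingletonClass A] in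
theorem IsUniform.sum_pow_column [DecidableEq A] (h : IsUniform M n) (k : ℕ) (b : A) :
    ∑ a, (M ^ k) a b = (n : ℤ) ^ k := by
  induction k generalizing b with
  | zero => simp [Matrix.one_apply]
  | succ k ih =>
    simp_rw [pow_succ, Matrix.mul_apply]
    rw [Finset.sum_comm]
    simp_rw [← Finset.sum_mul, ih, ← Finset.mul_sum, h.2]

omit [MeasurableSingletonClass A] [TopologicalSpace A] [DiscreteTopology A] in
theorem IsIASFT.degree_pos (hM : IsIASFT M μ) (h : IsUniform M n) : 0 < n := by
  obtain ⟨a⟩ := hM.nonempty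
  refine Nat.pos_of_ne_zero ?_
  rintro rfl
  obtain ⟨k, hk, hpos⟩ := (Matrix.isIrreducible_iff_exists_pow_pos hM.irreducible.nonneg).1
    hM.irreducible a a
  have hsum := h.sum_pow_column k a
  rw [Nat.cast_zero, zero_pow hk.ne'] at hsum
  exact hpos.ne' ((Finset.sum_eq_zero_iff_of_nonneg fun b _ =>
    Matrix.pow_apply_nonneg hM.irreducible.nonneg k b a).1 hsum a (Finset.mem_univ a))

/-- The sum is the probability of `a` at time 0 and `b` at time `k`. Constants are Perron
eigenvectors with value `n`, so each step has probability `M / n`. -/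
theorem IsIASFT.sum_wordProb_of_isUniform (hM : IsIASFT M μ) (h : IsUniform M n) (k : ℕ) (a b : A) :
    (n : ℝ) ^ k * ∑ w : Fin (k + 1) → A,
        wordProb μ w * (if w 0 = a ∧ w (Fin.last k) = b then 1 else 0)
      = wordProb μ (fun _ : Fin 1 => a) * (M ^ k) a b := by
  have hn : (0 : ℝ) < n := by exact_mod_cast hM.degree_pos h
  have hstep : ∀ {k : ℕ} (w : Fin (k + 1) → A) (b : A),
      wordProb μ (Fin.snoc w b : Fin (k + 2) → A) = wordProb μ w * (M (w (Fin.last k)) b / n) := by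
    intro k w b
    have hrt : (M.map (Int.cast : ℤ → ℝ)).mulVec 1 = (n : ℝ) • 1 := by
      funext a
      have := h.1 a
      simp only [Matrix.mulVec, dotProduct, Matrix.map_apply, Pi.one_apply, mul_one, Pi.smul_apply,
        smul_eq_mul]
      exact_mod_cast this
    rw [hM.wordProb_snoc hn (fun _ => one_pos) hrt]
    simp [parryMatrix]
  induction k generalizing b with
  | zero =>
    have huniq : ∀ w : Fin 1 → A, w 0 = a ↔ w = fun _ => a := fun w =>
      ⟨fun hw => funext fun i => by rw [Subsingleton.elim i 0, hw], fun hw => hw ▸ rfl⟩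
    have hsum : ∀ w : Fin 1 → A, wordProb μ w * (if w 0 = a ∧ w (Fin.last 0) = b then 1 else 0)
        = if w = fun _ => a then wordProb μ w * (if a = b then 1 else 0) else 0 := by
      intro w
      by_cases hw : w = fun _ => a
      · simp [hw]
      · have := mt (huniq w).1 hw
        simp [hw, this]
    refine (congrArg _ (Finset.sum_congr rfl fun w _ => hsum w)).trans ?_
    simp [Matrix.one_apply]
  | succ k ih =>
    have h0 : ∀ (w : Fin (k + 1) → A) (c : A), (Fin.snoc w c : Fin (k + 2) → A) 0 = w 0 :=
      fun w c => Fin.snoc_castSucc (α := fun _ => A) c w 0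
    have hlast : ∀ w : Fin (k + 1) → A,
        ∑ c, wordProb μ (Fin.snoc w c : Fin (k + 2) → A) * (if w 0 = a ∧ c = b then (1 : ℝ) else 0)
        = ∑ d, wordProb μ w * (if w 0 = a ∧ w (Fin.last k) = d then 1 else 0) * (M d b / n) := by
      intro w
      by_cases hw : w 0 = a <;> simp [hw, hstep]
    rw [sum_snoc]
    simp only [h0, Fin.snoc_last, hlast]
    rw [Finset.sum_comm, pow_succ M, Matrix.mul_apply]
    push_cast
    rw [Finset.mul_sum, Finset.mul_sum]
    refine Finset.sum_congr rfl fun d _ => ?_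
    rw [← Finset.sum_mul, ← mul_assoc (wordProb μ _), ← ih d]
    field_simp
    ring

theorem IsIASFT.pow_apply_eq (hM : IsIASFT M μ) (h : IsUniform M n) {k : ℕ}
    (hind : IndepFun (block 0 1) (block k 1) μ) (a b : A) :
    ((M ^ k) a b : ℝ) = (n : ℝ) ^ k / Fintype.card A := by
  have := hM.nonempty
  have := hM.maxEntropy.invariantProb.isProbabilityMeasure
  have hμ := hM.maxEntropy.invariantProb.invariant
  have hn : (0 : ℝ) < n := by exact_mod_cast hM.degree_pos h
  have hletter : ∀ (l : ℤ) (c : A), block l 1 ⁻¹' {fun _ => c} = {x | x l = c} := fun l c => by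
    ext x
    simp [block, funext_iff]
  -- Independence makes the entry depend on `b` alone; the column sum then forces each letter to
  -- have probability `1 / |A|`.
  have hpow : ∀ a b, ((M ^ k) a b : ℝ) = (n : ℝ) ^ k * wordProb μ (fun _ : Fin 1 => b) := by
    intro a b
    have h1 := hM.sum_wordProb_of_isUniform h k a b
    have h2 := real_preimage_eq_sum (P := μ) (measurable_block 0 (k + 1))
      {w | w 0 = a ∧ w (Fin.last k) = b}
    have h3 := hind.real_inter (measurableSet_singleton fun _ => a)
      (measurableSet_singleton fun _ => b)
    have h4 : block 0 (k + 1) ⁻¹' {w : Fin (k + 1) → A | w 0 = a ∧ w (Fin.last k) = b}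
        = block 0 1 ⁻¹' {fun _ => a} ∩ block k 1 ⁻¹' {fun _ => b} := by
      rw [hletter, hletter]
      ext x
      simp [block]
    rw [h4, h3, real_block_eq_wordProb hμ, real_block_eq_wordProb hμ] at h2
    simp only [Set.mem_ofPred_eq] at h2
    have h5 : ∀ w : Fin (k + 1) → A, μ.real (block 0 (k + 1) ⁻¹' {w}) = wordProb μ w := fun w => rfl
    simp_rw [h5] at h2
    rw [← h2] at h1
    have ha := hM.wordProb_letter_pos fun _ => a
    refine mul_left_cancel₀ ha.ne' ?_
    rw [← h1]
    ring
  have hcol : ((∑ a, (M ^ k) a b : ℤ) : ℝ) = (n : ℝ) ^ k := by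
    rw [h.sum_pow_column]
    push_cast
    rfl
  push_cast at hcol
  simp_rw [hpow, Finset.sum_const, Finset.card_univ, nsmul_eq_mul] at hcol
  have hcard : (Fintype.card A : ℝ) ≠ 0 := by simp
  rw [hpow, eq_div_iff hcard, mul_comm, hcol]

end Uniform

end Main

end PIJ

theorem mainTheorem4 {A : Type*} [Fintype A] [DecidableEq A]
    [TopologicalSpace A] [DiscreteTopology A] [MeasurableSpace A] [MeasurableSingletonClass A]
    {Ω : Type*} [MeasurableSpace Ω] (P : Measure Ω) [IsProbabilityMeasure P]
    (ξ : ℤ → Ω → A) (hξ : ∀ i, Measurable (ξ i))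
    (M : Matrix A A ℤ) (hM : PIJ.IsIASFT M (PIJ.law P ξ)) (hPIJ : PIJ.HasPIJ (PIJ.law P ξ)) :
    (∀ᶠ k : ℕ in atTop,
      IndepFun (fun ω (i : Set.Iic (0 : ℤ)) => ξ i ω)
        (fun ω (i : Set.Ici (k : ℤ)) => ξ i ω) P) ∧
    ∀ n : ℕ, PIJ.IsUniform M n →
      ∀ᶠ k : ℕ in atTop, ∀ a b : A,
        ((M ^ k) a b : ℚ) = (n : ℚ) ^ k / (Fintype.card A : ℚ) := by
  obtain ⟨K, hK⟩ := hM.exists_indepFun_block hPIJ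
  refine ⟨?_, fun n hn => ?_⟩
  · filter_upwards [eventually_ge_atTop K] with k hk
    exact PIJ.indepFun_past_future hξ fun a n m ha => hK a k n m (by omega)
  · filter_upwards [eventually_ge_atTop K] with k hk a b
    have := hM.pow_apply_eq hn (k := k) (hK 0 k 0 0 (by simpa using hk)) a b
    refine Rat.cast_injective (α := ℝ) ?_
    push_cast
    exact this
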